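/- **Theorem (Euler–Lagrange equation for $L^r$ local minimisers).** Let $dp$ be the surface measure on the unit sphere $\mathbb S^2\subset\mathbb R^3$, let $\mathrm{Sym}_0(3)$ be the space of symmetric traceless real $3\times3$ matrices with scalar product $A\cdot B=\sum_{i,j}A_{ij}B_{ij}$, and let $$\mathcal P(\mathbb S^2)=\Big\{f\in L^1(\mathbb S^2): f\ge 0 \text{ a.e.},\ \int_{\mathbb S^2}f\,dp=1\Big\}.$$ Let $\eta\in\mathbb R$ and define $\mathcal F:\mathcal P(\mathbb S^2)\to\mathbb R\cup\{+\infty\}$ by $$\mathcal F(f)=\int_{\mathbb S^2} f(p)\ln f(p)-f(p)\ln\Big(\int_{\mathbb S^2}\big((p\cdot q)^2-\tfrac13\big)f(q)\,dq-\eta\Big)\,dp,$$ where $-\ln$ is extended by $+\infty$ to non-positive arguments and $0\cdot(+\infty)=0$. Let $J(Q)$ be the infimum of $\mathcal F(g)$ over all $g\in\mathcal P(\mathbb S^2)$ with $\int_{\mathbb S^2}(p\otimes p-\frac13I)g(p)\,dp=Q$, and let $\mathrm{dom}(J)$ be the set of all $Q\in\mathrm{Sym}_0(3)$ whose eigenvalues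 are all $>-\frac13$ and for which $J(Q)<+\infty$; this set is open in $\mathrm{Sym}_0(3)$. The dual function is $$F(Q,\lambda)=\lambda\cdot Q-\ln\Big(\int_{\mathbb S^2}\exp(\lambda p\cdot p)\max(Qp\cdot p-\eta,0)\,dp\Big),\qquad Q\in\mathrm{dom}(J),\ \lambda\in\mathrm{Sym}_0(3).$$ Let $r\in[1,\infty]$ and let $f\in\mathcal P(\mathbb S^2)$ be an $L^r$-local minimiser of $\mathcal F$ with finite energy, that is, $\mathcal F(f)<+\infty$ and there is $\varepsilon>0$ such that $\mathcal F(f)\le\mathcal F(g)$ for all $g\in\mathcal P(\mathbb S^2)$ with $\|g-f\|_{L^r}<\varepsilon$. Then there are $Q,\Lambda\in\mathrm{Sym}_0(3)$ such that $Z=\int_{\mathbb S^2}\exp(\Lambda p\cdot p)\max(Qp\cdot p-\eta,0)\,dp$ is positive, the function $f(p)/(Qp\cdot p-\eta)$ (understood as $0$ where $Qp\cdot p=\eta$) is integrable on $\mathbb S^2$, and $$\begin{aligned} f(p)&=\frac1Z\exp(\Lambda p\cdot p)\max(Qp\cdot p-\eta,0)\quad\text{for a.e. }p\in\mathbb S^2,\\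 Q&=\int_{\mathbb S^2}f(p)\Big(p\otimes p-\frac13I\Big)\,dp,\\ \Lambda&=\int_{\mathbb S^2}\frac{f(p)}{Qp\cdot p-\eta}\Big(p\otimes p-\frac13I\Big)\,dp. \end{aligned}$$ Furthermore, $(Q,\Lambda)$ is a critical point of $F$: $Q\in\mathrm{dom}(J)$, and $F$ is differentiable at $(Q,\Lambda)$, jointly in both variables, with derivative zero. -/

import Mathlib

open MeasureTheory
open scoped ENNReal

noncomputable section

namespace QTensorModel

/-- The unit sphere in three-dimensional Euclidean space. -/
abbrev Sphere2 : Type := Metric.sphere (0 : EuclideanSpace ℝ (Fin 3)) 1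

/-- Surface measure on the unit sphere (the two-dimensional Hausdorff measure in its usual
normalisation, for which the sphere has area `4 * π`). -/
def surfaceMeasure : Measure Sphere2 :=
  (volume : Measure (EuclideanSpace ℝ (Fin 3))).toSphere

/-- The real vector space of symmetric traceless `3 × 3` matrices. -/
def SymTraceless : Submodule ℝ (Matrix (Fin 3) (Fin 3) ℝ) where
  carrier := {A | A.transpose = A ∧ A.trace = 0}
  add_mem' := by
    rintro A B ⟨hA, hA'⟩ ⟨hB, hB'⟩
    exact ⟨by rw [Matrix.transpose_add, hA, hB], by rw [Matrix.trace_add, hA', hB', add_zero]⟩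
  zero_mem' := ⟨Matrix.transpose_zero, Matrix.trace_zero _ _⟩
  smul_mem' := by
    rintro c A ⟨hA, hA'⟩
    exact ⟨by rw [Matrix.transpose_smul, hA], by rw [Matrix.trace_smul, hA', smul_zero]⟩

/-- The quadratic form `A p · p`. -/
def quad (A : Matrix (Fin 3) (Fin 3) ℝ) (p : Sphere2) : ℝ :=
  ∑ i, ∑ j, A i j * p.1 i * p.1 j

/-- The scalar product `A · B` of matrices. -/
def frobeniusInner (A B : Matrix (Fin 3) (Fin 3) ℝ) : ℝ :=
  ∑ i, ∑ j, A i j * B i j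

/-- Probability densities on the sphere: integrable, nonnegative almost everywhere, of mass one. -/
def IsProbDensity (f : Sphere2 → ℝ) : Prop :=
  Integrable f surfaceMeasure ∧ (∀ᵐ p ∂surfaceMeasure, 0 ≤ f p) ∧ ∫ p, f p ∂surfaceMeasure = 1

/-- The matrix `∫ (p ⊗ p - I / 3) g(p) dp`, computed entry by entry. For a probability density `g`
this is its Q-tensor. -/
def moment (g : Sphere2 → ℝ) : Matrix (Fin 3) (Fin 3) ℝ :=
  Matrix.of fun i j =>
    ∫ p : Sphere2, (p.1 i * p.1 j - (1 / 3) * (1 : Matrix (Fin 3) (Fin 3) ℝ) i j) * g p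
      ∂surfaceMeasure

/-- The function `- ln`, extended by `+∞` to nonpositive arguments. -/
def negLog (x : ℝ) : EReal := if 0 < x then ((-Real.log x : ℝ) : EReal) else ⊤

/-- The integral of an extended-real function: the integral of its positive part minus the
integral of its negative part. -/
def extIntegral (e : Sphere2 → EReal) : EReal :=
  ((∫⁻ p, (e p).toENNReal ∂surfaceMeasure : ℝ≥0∞) : EReal)
    - ((∫⁻ p, (-e p).toENNReal ∂surfaceMeasure : ℝ≥0∞) : EReal)

/-- The energy
`∫ f(p) ln f(p) - f(p) ln (∫ ((p · q)² - 1 / 3) f(q) dq - η) dp`, with values in the extended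
reals. The product in `EReal` obeys `0 * ⊤ = 0`. For a probability density the integrand is bounded
below by an integrable function, so that the energy is a real number or `+∞`. -/
def energy (η : ℝ) (f : Sphere2 → ℝ) : EReal :=
  extIntegral fun p =>
    ((f p * Real.log (f p) : ℝ) : EReal)
      + (f p : EReal)
        * negLog ((∫ q : Sphere2, ((inner ℝ p.1 q.1) ^ 2 - 1 / 3) * f q ∂surfaceMeasure) - η)

/-- `f` minimises the energy among the probability densities in some `L^r` ball around `f`. -/
def IsLpLocalMin (η : ℝ) (r : ℝ≥0∞) (f : Sphere2 → ℝ) : Prop :=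
  IsProbDensity f ∧ ∃ ε : ℝ, 0 < ε ∧ ∀ g : Sphere2 → ℝ, IsProbDensity g →
    eLpNorm (g - f) r surfaceMeasure < ENNReal.ofReal ε → energy η f ≤ energy η g

/-- The physical Q-tensors: all eigenvalues are greater than `-1 / 3`. -/
def IsPhysical (Q : SymTraceless) : Prop :=
  ∀ v : ℝ, Module.End.HasEigenvalue (Matrix.toLin' (Q : Matrix (Fin 3) (Fin 3) ℝ)) v → -(1 / 3) < v

/-- The auxiliary function `J(Q)`: the infimum of the energy over the probability densities with
Q-tensor `Q`. -/
def auxiliary (η : ℝ) (Q : SymTraceless) : EReal :=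
  ⨅ f ∈ {f : Sphere2 → ℝ | IsProbDensity f ∧ moment f = Q}, energy η f

/-- The effective domain of `J`. -/
def domAuxiliary (η : ℝ) : Set SymTraceless :=
  {Q | IsPhysical Q ∧ auxiliary η Q < ⊤}

/-- The integral `∫ exp(lam p · p) max(Q p · p - η, 0) dp`. -/
def partitionFn (η : ℝ) (Q lam : SymTraceless) : ℝ :=
  ∫ p, Real.exp (quad lam p) * max (quad Q p - η) 0 ∂surfaceMeasure

/-- The dual function
`F(Q, lam) = lam · Q - ln (∫ exp(lam p · p) max(Q p · p - η, 0) dp)`. -/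
def dualFn (η : ℝ) (x : SymTraceless × SymTraceless) : ℝ :=
  frobeniusInner x.2 x.1 - Real.log (partitionFn η x.1 x.2)

/-- `(Q, lam)` is a critical point of the dual function on `dom J × SymTraceless`: the point lies
in the domain, and `F` is Fréchet differentiable there, jointly in both variables, with derivative
zero. `SymTraceless` carries its usual topology as a finite-dimensional real vector space, and
neighbourhoods are taken in `SymTraceless × SymTraceless`. -/
def IsDualCriticalPoint (η : ℝ) (Q lam : SymTraceless) : Prop :=
  Q ∈ domAuxiliary η ∧
    HasFDerivAt (dualFn η) (0 : (SymTraceless × SymTraceless) →L[ℝ] ℝ) (Q, lam)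

end QTensorModel

end

noncomputable section

namespace QTensorModel

/-! Write `u(p) = Qp·p - η` with `Q` the Q-tensor of `f`, and `v = exp(Bp·p) max(u, 0)` for a
symmetric matrix `B`. Up to null sets a density of finite energy vanishes where `u ≤ 0`, and its
energy equals the relative entropy with respect to `v`, plus `1 - ∫ v`, plus the product of `B` with
the second moment (`IsAdmissible.integral_energyDensity`). Here `B` is free. The second moment
determines both the mass and `Q`, so a variation that keeps it changes only the relative entropy.
All competitors are uniformly close to `f`, hence close in every `L^r`.

The constraints are restored by correctors. On any set of positive measure the quadratic forms
realise every symmetric second moment, with a linear bound, because a nonzero quadratic form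
vanishes only on a null set (`exists_quad_secondMoment`).

On a set `S` where `f` and `u` are bounded above and away from zero, perturbing `f` by the part of
`ln(f/u)` orthogonal to the quadratic forms shows `f = v` on `S` for some `B`
(`IsUniformLocalMin.exists_eq_profile_on`). Moving `f` towards `v` elsewhere lowers the relative
entropy at first order by convexity, while the correction on `S`, where `f = v`, costs only second
order. Hence `f = v` a.e. (`IsUniformLocalMin.exists_eq_profile`), without any lower bound on `f`
off `S`.

Varying `Q` in a traceless direction `M` gives `∫ (Mp·p) f/u = B·M`
(`IsUniformLocalMin.integral_quad_eq`), so `Λ` is the traceless part of `B`. The equations for `Q`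
and `Λ` then say that both partial derivatives of the dual function vanish. It is differentiable in
spite of the positive part, because `{u = 0}` is a null set. -/

instance : IsFiniteMeasure surfaceMeasure := by unfold surfaceMeasure; infer_instance

/-! ### Quadratic forms and moments on the sphere -/

/-- The sum of the absolute values of the entries of a matrix. -/
def entrySum (A : Matrix (Fin 3) (Fin 3) ℝ) : ℝ := ∑ i, ∑ j, |A i j|

/-- The second moment `∫ (p ⊗ p) g(p) dp`. -/
def secondMoment (g : Sphere2 → ℝ) : Matrix (Fin 3) (Fin 3) ℝ :=
  Matrix.of fun i j => ∫ p : Sphere2, p.1 i * p.1 j * g p ∂surfaceMeasure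

lemma sum_sq_coord (p : Sphere2) : ∑ i, p.1 i * p.1 i = 1 := by
  have h : ‖p.1‖ = 1 := by simp
  have := EuclideanSpace.real_norm_sq_eq p.1
  rw [h, one_pow] at this
  exact (Finset.sum_congr rfl fun i _ => (sq _).symm).trans this.symm

lemma abs_coord_le_one (p : Sphere2) (i : Fin 3) : |p.1 i| ≤ 1 := by
  have h := Finset.single_le_sum (f := fun i => p.1 i * p.1 i)
    (fun i _ => mul_self_nonneg _) (Finset.mem_univ i)
  rw [sum_sq_coord] at h
  exact abs_le_one_iff_mul_self_le_one.2 h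

@[fun_prop]
lemma measurable_coord (i : Fin 3) : Measurable fun p : Sphere2 => p.1 i :=
  ((EuclideanSpace.proj (𝕜 := ℝ) i).continuous.comp continuous_subtype_val).measurable

@[fun_prop]
lemma measurable_quad (A : Matrix (Fin 3) (Fin 3) ℝ) : Measurable (quad A) := by
  unfold quad; fun_prop

lemma abs_quad_le (A : Matrix (Fin 3) (Fin 3) ℝ) (p : Sphere2) : |quad A p| ≤ entrySum A := by
  unfold quad entrySum
  refine (Finset.abs_sum_le_sum_abs _ _).trans (Finset.sum_le_sum fun i _ => ?_)
  refine (Finset.abs_sum_le_sum_abs _ _).trans (Finset.sum_le_sum fun j _ => ?_)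
  rw [abs_mul, abs_mul]
  have := mul_le_one₀ (abs_coord_le_one p i) (abs_nonneg _) (abs_coord_le_one p j)
  nlinarith [abs_nonneg (A i j)]

lemma entrySum_nonneg (A : Matrix (Fin 3) (Fin 3) ℝ) : 0 ≤ entrySum A :=
  Finset.sum_nonneg fun _ _ => Finset.sum_nonneg fun _ _ => abs_nonneg _

lemma quad_add (A B : Matrix (Fin 3) (Fin 3) ℝ) (p : Sphere2) :
    quad (A + B) p = quad A p + quad B p := by
  simp [quad, add_mul, Finset.sum_add_distrib]

lemma quad_smul (c : ℝ) (A : Matrix (Fin 3) (Fin 3) ℝ) (p : Sphere2) :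
    quad (c • A) p = c * quad A p := by
  simp [quad, Finset.mul_sum, mul_assoc]

lemma quad_one (p : Sphere2) : quad 1 p = 1 := by
  rw [← sum_sq_coord p]
  simp [quad, Matrix.one_apply]

lemma quad_sub (A B : Matrix (Fin 3) (Fin 3) ℝ) (p : Sphere2) :
    quad (A - B) p = quad A p - quad B p := by
  simp [quad, sub_mul, Finset.sum_sub_distrib]

lemma integrable_mul_of_bounded {g k : Sphere2 → ℝ} (hg : Integrable g surfaceMeasure)
    (hk : Measurable k) {C : ℝ} (hC : ∀ p, |k p| ≤ C) :
    Integrable (fun p => k p * g p) surfaceMeasure :=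
  hg.bdd_mul hk.aestronglyMeasurable (Filter.Eventually.of_forall hC)

lemma integrable_of_bounded {k : Sphere2 → ℝ} (hk : Measurable k) {C : ℝ}
    (hC : ∀ p, |k p| ≤ C) : Integrable k surfaceMeasure :=
  Integrable.of_bound hk.aestronglyMeasurable C (Filter.Eventually.of_forall hC)

lemma abs_coord_mul_le_one (p : Sphere2) (i j : Fin 3) : |p.1 i * p.1 j| ≤ 1 := by
  rw [abs_mul]
  exact mul_le_one₀ (abs_coord_le_one p i) (abs_nonneg _) (abs_coord_le_one p j)

lemma integrable_coord_mul {g : Sphere2 → ℝ} (hg : Integrable g surfaceMeasure) (i j : Fin 3) :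
    Integrable (fun p : Sphere2 => p.1 i * p.1 j * g p) surfaceMeasure :=
  integrable_mul_of_bounded hg (by fun_prop) (fun p => abs_coord_mul_le_one p i j)

lemma integrable_quad_mul {g : Sphere2 → ℝ} (hg : Integrable g surfaceMeasure)
    (A : Matrix (Fin 3) (Fin 3) ℝ) :
    Integrable (fun p : Sphere2 => quad A p * g p) surfaceMeasure :=
  integrable_mul_of_bounded hg (by fun_prop) (abs_quad_le A)

lemma integral_quad_mul {g : Sphere2 → ℝ} (hg : Integrable g surfaceMeasure)
    (A : Matrix (Fin 3) (Fin 3) ℝ) :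
    ∫ p, quad A p * g p ∂surfaceMeasure = frobeniusInner A (secondMoment g) := by
  have h : ∀ p : Sphere2, quad A p * g p = ∑ i, ∑ j, A i j * (p.1 i * p.1 j * g p) := by
    intro p
    simp only [quad, Finset.sum_mul]
    exact Finset.sum_congr rfl fun i _ => Finset.sum_congr rfl fun j _ => by ring
  simp only [h, frobeniusInner, secondMoment, Matrix.of_apply]
  have hi : ∀ i j, Integrable (fun p : Sphere2 => A i j * (p.1 i * p.1 j * g p)) surfaceMeasure :=
    fun i j => (integrable_coord_mul hg i j).const_mul (A i j)
  refine (integral_finsetSum _ fun i _ => integrable_finsetSum _ fun j _ => hi i j).trans ?_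
  refine Finset.sum_congr rfl fun i _ => ?_
  refine (integral_finsetSum _ fun j _ => hi i j).trans ?_
  exact Finset.sum_congr rfl fun j _ => integral_const_mul _ _

lemma secondMoment_transpose (g : Sphere2 → ℝ) :
    (secondMoment g).transpose = secondMoment g := by
  ext i j
  simp only [secondMoment, Matrix.transpose_apply, Matrix.of_apply]
  congr 1; ext p; ring

/-- `p ⊗ p` has trace one on the sphere. Thus keeping the second moment preserves the unit mass and
the Q-tensor together. -/
lemma trace_secondMoment {g : Sphere2 → ℝ} (hg : Integrable g surfaceMeasure) :
    (secondMoment g).trace = ∫ p, g p ∂surfaceMeasure := by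
  have h := integral_quad_mul hg 1
  simp only [quad_one, one_mul] at h
  rw [h]
  simp [frobeniusInner, Matrix.one_apply, Matrix.trace]

lemma moment_eq {g : Sphere2 → ℝ} (hg : Integrable g surfaceMeasure) :
    moment g = secondMoment g - ((1 / 3) * (secondMoment g).trace) • 1 := by
  ext i j
  rw [trace_secondMoment hg]
  simp only [moment, secondMoment, Matrix.of_apply, Matrix.sub_apply, Matrix.smul_apply,
    smul_eq_mul]
  rw [mul_right_comm, ← integral_const_mul, ← integral_sub (integrable_coord_mul hg i j)
    (hg.const_mul _)]
  congr 1; ext p; ring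

lemma moment_mem {g : Sphere2 → ℝ} (hg : Integrable g surfaceMeasure) :
    moment g ∈ SymTraceless := by
  rw [moment_eq hg]
  refine ⟨?_, ?_⟩
  · rw [Matrix.transpose_sub, secondMoment_transpose, Matrix.transpose_smul, Matrix.transpose_one]
  · rw [Matrix.trace_sub, Matrix.trace_smul, Matrix.trace_one]
    simp; ring

lemma moment_congr {g h : Sphere2 → ℝ} (hgh : g =ᵐ[surfaceMeasure] h) :
    moment g = moment h := by
  ext i j
  simp only [moment, Matrix.of_apply]
  refine integral_congr_ae ?_
  filter_upwards [hgh] with p hp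
  rw [hp]

lemma secondMoment_add {g h : Sphere2 → ℝ} (hg : Integrable g surfaceMeasure)
    (hh : Integrable h surfaceMeasure) :
    secondMoment (fun p => g p + h p) = secondMoment g + secondMoment h := by
  ext i j
  simp only [secondMoment, Matrix.of_apply, Matrix.add_apply, mul_add]
  exact integral_add (integrable_coord_mul hg i j) (integrable_coord_mul hh i j)

lemma secondMoment_sub {g h : Sphere2 → ℝ} (hg : Integrable g surfaceMeasure)
    (hh : Integrable h surfaceMeasure) :
    secondMoment (fun p => g p - h p) = secondMoment g - secondMoment h := by
  ext i j
  simp only [secondMoment, Matrix.of_apply, Matrix.sub_apply, mul_sub]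
  exact integral_sub (integrable_coord_mul hg i j) (integrable_coord_mul hh i j)

lemma secondMoment_smul (c : ℝ) (g : Sphere2 → ℝ) :
    secondMoment (fun p => c * g p) = c • secondMoment g := by
  ext i j
  simp only [secondMoment, Matrix.of_apply, Matrix.smul_apply, smul_eq_mul]
  rw [← integral_const_mul]
  congr 1; ext p; ring

lemma entrySum_secondMoment_le {g : Sphere2 → ℝ} {C : ℝ} (hC : ∀ p, |g p| ≤ C) :
    entrySum (secondMoment g) ≤ 9 * (C * surfaceMeasure.real Set.univ) := by
  have h : ∀ i j, |secondMoment g i j| ≤ C * surfaceMeasure.real Set.univ := by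
    intro i j
    have hb : ∀ p : Sphere2, ‖p.1 i * p.1 j * g p‖ ≤ C := fun p => by
      rw [Real.norm_eq_abs, abs_mul]
      have := abs_coord_mul_le_one p i j
      nlinarith [hC p, abs_nonneg (g p)]
    exact norm_integral_le_of_norm_le_const (Filter.Eventually.of_forall hb)
  calc entrySum (secondMoment g)
      ≤ ∑ i : Fin 3, ∑ j : Fin 3, C * surfaceMeasure.real Set.univ :=
        Finset.sum_le_sum fun i _ => Finset.sum_le_sum fun j _ => h i j
    _ = _ := by simp; ring

lemma frobeniusInner_comm (A B : Matrix (Fin 3) (Fin 3) ℝ) :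
    frobeniusInner A B = frobeniusInner B A := by
  simp only [frobeniusInner, mul_comm]

/-! ### Zero sets of quadratic forms are null -/

/-- The quadratic form of a matrix on the whole space. -/
def quadForm (A : Matrix (Fin 3) (Fin 3) ℝ) (x : EuclideanSpace ℝ (Fin 3)) : ℝ :=
  ∑ i, ∑ j, A i j * x i * x j

/-- The symmetrised bilinear form of a matrix. -/
def quadPolar (A : Matrix (Fin 3) (Fin 3) ℝ) (x v : EuclideanSpace ℝ (Fin 3)) : ℝ :=
  ∑ i, ∑ j, A i j * (x i * v j + v i * x j)

lemma quadForm_add_smul (A : Matrix (Fin 3) (Fin 3) ℝ) (x v : EuclideanSpace ℝ (Fin 3)) (t : ℝ) :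
    quadForm A (x + t • v) = quadForm A v * (t * t) + quadPolar A x v * t + quadForm A x := by
  simp only [quadForm, quadPolar, Finset.sum_mul, ← Finset.sum_add_distrib]
  refine Finset.sum_congr rfl fun i _ => Finset.sum_congr rfl fun j _ => ?_
  simp; ring

lemma exists_quadForm_ne_zero {A : Matrix (Fin 3) (Fin 3) ℝ} (hA : A.transpose = A)
    (h0 : A ≠ 0) : ∃ v, quadForm A v ≠ 0 := by
  by_contra! h
  apply h0
  have hs : ∀ i j, A j i = A i j := fun i j => congrFun (congrFun hA i) j
  ext i j
  have hp := quadForm_add_smul A (EuclideanSpace.single i 1) (EuclideanSpace.single j 1) 1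
  rw [h, h, h] at hp
  simp [quadPolar, mul_add, Finset.sum_add_distrib, hs i j] at hp
  simpa using by linarith

lemma volume_quadForm_eq_zero {A : Matrix (Fin 3) (Fin 3) ℝ} (hA : A.transpose = A)
    (h0 : A ≠ 0) : volume {x | quadForm A x = 0} = 0 := by
  obtain ⟨v, hv⟩ := exists_quadForm_ne_zero hA h0
  have hm : MeasurableSet {x | quadForm A x ≠ 0} := by
    have : Continuous (quadForm A) := by unfold quadForm; fun_prop
    exact (this.measurable (measurableSet_singleton 0)).compl
  have key : ∀ᵐ x, x ∈ {x | quadForm A x ≠ 0} := by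
    -- Fubini along lines in direction `v`: there the form is a quadratic polynomial with leading
    -- coefficient `quadForm A v ≠ 0`, so it has finitely many zeros.
    refine ae_mem_of_ae_add_linearMap_mem (LinearMap.toSpanSingleton ℝ _ v) volume volume hm ?_
    intro y
    have hf : {t : ℝ | quadForm A (y + t • v) = 0}.Finite := by
      let P : Polynomial ℝ := Polynomial.C (quadForm A v) * Polynomial.X ^ 2
        + Polynomial.C (quadPolar A y v) * Polynomial.X + Polynomial.C (quadForm A y)
      have hP : P ≠ 0 := by
        intro h
        have := congrArg (fun q => Polynomial.coeff q 2) h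
        simp [P] at this
        exact hv this
      refine (P.roots.toFinset.finite_toSet).subset fun t ht => ?_
      simp only [Finset.mem_coe, Multiset.mem_toFinset, Polynomial.mem_roots hP,
        Polynomial.IsRoot.def]
      rw [Set.mem_ofPred_eq, quadForm_add_smul] at ht
      simp [P]; linarith
    have := hf.measure_zero volume
    filter_upwards [compl_mem_ae_iff.2 this] with t ht
    simpa using ht
  simpa [ae_iff] using key

/-- Surface measure is computed from the volume of cones, and by homogeneity the cone over the zeros
on the sphere lies in the zero set in space. -/
lemma ae_quad_ne_zero {A : Matrix (Fin 3) (Fin 3) ℝ} (hA : A.transpose = A) (h0 : A ≠ 0) :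
    ∀ᵐ p ∂surfaceMeasure, quad A p ≠ 0 := by
  have hm : MeasurableSet {p | quad A p = 0} := measurable_quad A (measurableSet_singleton 0)
  rw [ae_iff]
  simp only [ne_eq, not_not]
  rw [surfaceMeasure, Measure.toSphere_apply' _ hm]
  refine mul_eq_zero_of_right _ (measure_mono_null ?_ (volume_quadForm_eq_zero hA h0))
  rintro _ ⟨t, _, _, ⟨p, hp, rfl⟩, rfl⟩
  have h := quadForm_add_smul A 0 p.1 t
  have h2 : quadForm A p.1 = 0 := hp
  rw [h2] at h
  simpa [quadForm, quadPolar] using h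

/-! ### Correctors for the second moment -/

/-- Symmetric matrices. -/
def SymMatrix : Submodule ℝ (Matrix (Fin 3) (Fin 3) ℝ) where
  carrier := {A | A.transpose = A}
  add_mem' := by
    intro A B (hA : A.transpose = A) (hB : B.transpose = B)
    change (A + B).transpose = A + B
    rw [Matrix.transpose_add, hA, hB]
  zero_mem' := Matrix.transpose_zero
  smul_mem' := by
    intro c A (hA : A.transpose = A)
    change (c • A).transpose = c • A
    rw [Matrix.transpose_smul, hA]

lemma integrable_indicator_quad {S : Set Sphere2} (hS : MeasurableSet S)
    (A : Matrix (Fin 3) (Fin 3) ℝ) : Integrable (S.indicator (quad A)) surfaceMeasure :=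
  (integrable_of_bounded (measurable_quad A) (abs_quad_le A)).indicator hS

/-- On a set of positive measure, quadratic forms realise every symmetric second moment. -/
lemma exists_quad_secondMoment {S : Set Sphere2} (hS : MeasurableSet S)
    (hpos : surfaceMeasure S ≠ 0) :
    ∃ C : ℝ, 0 ≤ C ∧ ∀ M : Matrix (Fin 3) (Fin 3) ℝ, M.transpose = M →
      ∃ A : Matrix (Fin 3) (Fin 3) ℝ, A.transpose = A ∧
        secondMoment (S.indicator (quad A)) = M ∧ entrySum A ≤ C * entrySum M := by
  classical
  let G : SymMatrix →ₗ[ℝ] SymMatrix :=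
    { toFun := fun A => ⟨secondMoment (S.indicator (quad A)), secondMoment_transpose _⟩
      map_add' := by
        intro A B
        ext1
        change secondMoment (S.indicator (quad (A.1 + B.1))) = _
        rw [Submodule.coe_add,
          ← secondMoment_add (integrable_indicator_quad hS _) (integrable_indicator_quad hS _)]
        congr 1; ext p
        by_cases hp : p ∈ S <;> simp [hp, quad_add]
      map_smul' := by
        intro c A
        ext1
        change secondMoment (S.indicator (quad (c • A.1))) = c • secondMoment _
        rw [← secondMoment_smul]
        congr 1; ext p
        by_cases hp : p ∈ S <;> simp [hp, quad_smul] }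
  -- `G` is the Gram operator of the quadratic forms in `L²(S)`: pairing `G A` with `A` gives `∫_S
  -- (Ap·p)²`, which is positive for `A ≠ 0`.
  have hinj : Function.Injective G := by
    rw [← LinearMap.ker_eq_bot, LinearMap.ker_eq_bot']
    intro A hA
    have hA' : secondMoment (S.indicator (quad A.1)) = 0 := congrArg Subtype.val hA
    by_contra hne
    have hne' : A.1 ≠ 0 := fun h => hne (Subtype.ext h)
    have hi := integrable_indicator_quad hS A.1
    have h1 := integral_quad_mul hi A.1
    rw [hA'] at h1
    have h2 : ∫ p, quad A.1 p * S.indicator (quad A.1) p ∂surfaceMeasure = 0 := by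
      rw [h1]; simp [frobeniusInner]
    rw [integral_eq_zero_iff_of_nonneg _ (integrable_quad_mul hi _)] at h2
    · apply hpos
      have : ∀ᵐ p ∂surfaceMeasure, p ∉ S := by
        filter_upwards [h2, ae_quad_ne_zero A.2 hne'] with p hp hq hpS
        simp [hpS, hq] at hp
      simpa [ae_iff] using this
    · intro p
      by_cases hp : p ∈ S <;> simp [hp, mul_self_nonneg]
  have hsurj : Function.Surjective G := LinearMap.injective_iff_surjective.1 hinj
  let e : SymMatrix ≃ₗ[ℝ] SymMatrix := LinearEquiv.ofBijective G ⟨hinj, hsurj⟩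
  have hcoord : ∀ i j, ∃ C : ℝ, 0 ≤ C ∧ ∀ M : SymMatrix, |(e.symm M).1 i j| ≤ C * entrySum M.1 := by
    intro i j
    -- The entry of the inverse is extended from symmetric matrices to all matrices, so that it can
    -- be expanded in matrix units, which need not be symmetric.
    obtain ⟨φ, hφ⟩ : ∃ φ : Matrix (Fin 3) (Fin 3) ℝ →ₗ[ℝ] ℝ,
        φ.comp SymMatrix.subtype = (Matrix.entryLinearMap ℝ ℝ i j).comp
          (SymMatrix.subtype.comp e.symm.toLinearMap) :=
      LinearMap.exists_extend _
    refine ⟨∑ k, ∑ l, |φ (Matrix.single k l 1)|, by positivity, fun M => ?_⟩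
    have h1 : (e.symm M).1 i j = φ M.1 := (LinearMap.congr_fun hφ M).symm
    have h2 : φ M.1 = ∑ k, ∑ l, M.1 k l * φ (Matrix.single k l 1) := by
      conv_lhs => rw [Matrix.matrix_eq_sum_single M.1]
      simp only [map_sum]
      refine Finset.sum_congr rfl fun k _ => Finset.sum_congr rfl fun l _ => ?_
      rw [← smul_eq_mul, ← map_smul, Matrix.smul_single, smul_eq_mul, mul_one]
    rw [h1, h2, Finset.sum_mul]
    have hle : ∀ k l, |M.1 k l| ≤ entrySum M.1 := fun k l =>
      (Finset.single_le_sum (f := fun l => |M.1 k l|) (fun _ _ => abs_nonneg _)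
        (Finset.mem_univ l)).trans
      (Finset.single_le_sum (f := fun k => ∑ l, |M.1 k l|)
        (fun _ _ => Finset.sum_nonneg fun _ _ => abs_nonneg _) (Finset.mem_univ k))
    refine (Finset.abs_sum_le_sum_abs _ _).trans (Finset.sum_le_sum fun k _ => ?_)
    rw [Finset.sum_mul]
    refine (Finset.abs_sum_le_sum_abs _ _).trans (Finset.sum_le_sum fun l _ => ?_)
    rw [abs_mul, mul_comm]
    exact mul_le_mul_of_nonneg_left (hle k l) (abs_nonneg _)
  choose C hC0 hC using hcoord
  refine ⟨∑ i, ∑ j, C i j, Finset.sum_nonneg fun i _ => Finset.sum_nonneg fun j _ => hC0 i j,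
    fun M hM => ⟨(e.symm ⟨M, hM⟩).1, (e.symm ⟨M, hM⟩).2, ?_, ?_⟩⟩
  · exact congrArg Subtype.val (e.apply_symm_apply ⟨M, hM⟩)
  · simp only [Finset.sum_mul]
    exact Finset.sum_le_sum fun i _ => Finset.sum_le_sum fun j _ => hC i j ⟨M, hM⟩

/-! ### Densities of finite energy -/

/-- The finite values of the integrand of the energy. -/
def energyDensity (η : ℝ) (g : Sphere2 → ℝ) (p : Sphere2) : ℝ :=
  g p * Real.log (g p) - g p * Real.log (quad (moment g) p - η)

/-- Densities that are measurable, nonnegative and of finite energy, with no exceptional null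
sets. -/
structure IsAdmissible (η : ℝ) (g : Sphere2 → ℝ) : Prop where
  measurable : Measurable g
  nonneg : ∀ p, 0 ≤ g p
  integrable : Integrable g surfaceMeasure
  integral_eq : ∫ p, g p ∂surfaceMeasure = 1
  eq_zero : ∀ p, quad (moment g) p - η ≤ 0 → g p = 0
  integrable_energyDensity : Integrable (energyDensity η g) surfaceMeasure

lemma IsAdmissible.isProbDensity {η : ℝ} {g : Sphere2 → ℝ} (h : IsAdmissible η g) :
    IsProbDensity g :=
  ⟨h.integrable, Filter.Eventually.of_forall h.nonneg, h.integral_eq⟩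

lemma measurable_energyDensity {η : ℝ} {g : Sphere2 → ℝ} (hg : Measurable g) :
    Measurable (energyDensity η g) := by
  unfold energyDensity; fun_prop

/-- `(p · q)²` is the quadratic form of `p ⊗ p` at `q`, so the nonlocal term sees the density only
through its Q-tensor. -/
lemma integral_kernel {g : Sphere2 → ℝ} (hg : Integrable g surfaceMeasure) (p : Sphere2) :
    ∫ q : Sphere2, ((inner ℝ p.1 q.1) ^ 2 - 1 / 3) * g q ∂surfaceMeasure = quad (moment g) p := by
  let P : Matrix (Fin 3) (Fin 3) ℝ := Matrix.of fun i j => p.1 i * p.1 j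
  have h1 : ∀ q : Sphere2, ((inner ℝ p.1 q.1) ^ 2 - 1 / 3) * g q
      = quad P q * g q - (1 / 3) * g q := by
    intro q
    have : quad P q = (inner ℝ p.1 q.1) ^ 2 := by
      simp only [quad, P, Matrix.of_apply, PiLp.inner_apply, sq, Finset.sum_mul_sum]
      refine Finset.sum_congr rfl fun i _ => Finset.sum_congr rfl fun j _ => ?_
      simp; ring
    rw [this]; ring
  simp only [h1]
  rw [integral_sub (integrable_quad_mul hg P) (hg.const_mul _), integral_quad_mul hg,
    integral_const_mul, moment_eq hg, quad_sub, quad_smul, quad_one, trace_secondMoment hg]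
  congr 1
  · simp only [frobeniusInner, quad, P, Matrix.of_apply]
    exact Finset.sum_congr rfl fun i _ => Finset.sum_congr rfl fun j _ => by ring
  · ring

lemma energy_eq {η : ℝ} {g : Sphere2 → ℝ} (hg : Integrable g surfaceMeasure) :
    energy η g = extIntegral fun p =>
      ((g p * Real.log (g p) : ℝ) : EReal) + (g p : EReal) * negLog (quad (moment g) p - η) := by
  unfold energy
  simp only [integral_kernel hg]

lemma extIntegral_congr {e e' : Sphere2 → EReal} (h : e =ᵐ[surfaceMeasure] e') :
    extIntegral e = extIntegral e' := by
  unfold extIntegral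
  congr 2
  · exact lintegral_congr_ae (h.mono fun p hp => by simp only [hp])
  · exact lintegral_congr_ae (h.mono fun p hp => by simp only [hp])

lemma energy_congr {η : ℝ} {f g : Sphere2 → ℝ} (hf : Integrable f surfaceMeasure)
    (h : f =ᵐ[surfaceMeasure] g) : energy η f = energy η g := by
  rw [energy_eq hf, energy_eq (hf.congr h), moment_congr h]
  refine extIntegral_congr (h.mono fun p hp => ?_)
  simp only [hp]

lemma extIntegral_coe {e : Sphere2 → ℝ} (he : Integrable e surfaceMeasure) :
    extIntegral (fun p => (e p : EReal)) = ((∫ p, e p ∂surfaceMeasure : ℝ) : EReal) := by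
  have h1 : ∫⁻ p, ENNReal.ofReal (e p) ∂surfaceMeasure ≠ ⊤ := he.lintegral_lt_top.ne
  have h2 : ∫⁻ p, ENNReal.ofReal (-e p) ∂surfaceMeasure ≠ ⊤ := he.neg.lintegral_lt_top.ne
  rw [integral_eq_lintegral_pos_part_sub_lintegral_neg_part he, EReal.coe_sub,
    EReal.coe_ennreal_toReal h1, EReal.coe_ennreal_toReal h2]
  unfold extIntegral
  simp only [← EReal.coe_neg, EReal.toENNReal_of_ne_top (EReal.coe_ne_top _), EReal.toReal_coe]

lemma integrand_eq_energyDensity {η : ℝ} {g : Sphere2 → ℝ} {p : Sphere2}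
    (h0 : quad (moment g) p - η ≤ 0 → g p = 0) :
    ((g p * Real.log (g p) : ℝ) : EReal) + (g p : EReal) * negLog (quad (moment g) p - η)
      = (energyDensity η g p : EReal) := by
  unfold energyDensity negLog
  split_ifs with h
  · rw [← EReal.coe_mul, ← EReal.coe_add]
    congr 1; ring
  · rw [h0 (not_lt.1 h)]; simp

lemma IsAdmissible.energy_eq {η : ℝ} {g : Sphere2 → ℝ} (h : IsAdmissible η g) :
    energy η g = ((∫ p, energyDensity η g p ∂surfaceMeasure : ℝ) : EReal) := by
  rw [QTensorModel.energy_eq h.integrable, ← extIntegral_coe h.integrable_energyDensity]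
  simp only [integrand_eq_energyDensity (h.eq_zero _)]

/-- This is `1 + y ≤ exp y` at `y = ln(v/x)`, multiplied by `x`. It bounds the energy density from
below and makes the relative entropy nonnegative. -/
lemma sub_le_mul_log_sub {x v : ℝ} (hx : 0 ≤ x) (hv : 0 < v) :
    x - v ≤ x * Real.log x - x * Real.log v := by
  rcases hx.eq_or_lt with rfl | hx
  · simp [hv.le]
  · have h := Real.add_one_le_exp (Real.log v - Real.log x)
    rw [Real.exp_sub, Real.exp_log hv, Real.exp_log hx, le_div_iff₀ hx] at h
    linarith

/-- A density of finite energy agrees almost everywhere with an admissible one. -/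
lemma exists_isAdmissible {η : ℝ} {f : Sphere2 → ℝ} (hf : IsProbDensity f)
    (hfin : energy η f < ⊤) : ∃ g, IsAdmissible η g ∧ g =ᵐ[surfaceMeasure] f := by
  obtain ⟨hint, hnn, hone⟩ := hf
  let f₁ : Sphere2 → ℝ := fun p => max (hint.1.mk f p) 0
  have hf₁m : Measurable f₁ := hint.1.stronglyMeasurable_mk.measurable.max measurable_const
  have hf₁ : f₁ =ᵐ[surfaceMeasure] f := by
    filter_upwards [hint.1.ae_eq_mk, hnn] with p h1 h2
    simp only [f₁, ← h1, h2, max_eq_left]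
  have hf₁i : Integrable f₁ surfaceMeasure := hint.congr hf₁.symm
  have hf₁nn : ∀ p, 0 ≤ f₁ p := fun p => le_max_right _ _
  rw [← energy_congr hf₁i hf₁, energy_eq hf₁i] at hfin
  set u : Sphere2 → ℝ := fun p => quad (moment f₁) p - η with hu
  have hum : Measurable u := by fun_prop
  set E : Sphere2 → EReal := fun p =>
    ((f₁ p * Real.log (f₁ p) : ℝ) : EReal) + (f₁ p : EReal) * negLog (u p) with hE
  have htop : ∀ p, u p ≤ 0 → f₁ p ≠ 0 → E p = ⊤ := by
    intro p h1 h2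
    have h3 : 0 < f₁ p := (hf₁nn p).lt_of_ne' h2
    simp only [hE, negLog, not_lt.2 h1, if_false]
    rw [EReal.coe_mul_top_of_pos h3, EReal.coe_add_top]
  have hreal : ∀ p, (u p ≤ 0 → f₁ p = 0) → E p = (energyDensity η f₁ p : EReal) :=
    fun p h => integrand_eq_energyDensity h
  let C := entrySum (moment f₁) + |η|
  have hlow : ∀ p, (u p ≤ 0 → f₁ p = 0) → -energyDensity η f₁ p ≤ C := by
    intro p h
    have hC : |u p| ≤ C := (abs_sub _ _).trans (add_le_add (abs_quad_le _ _) le_rfl)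
    rcases le_or_gt (u p) 0 with h0 | h0
    · simp only [energyDensity, h h0, zero_mul, sub_zero, neg_zero]
      exact (abs_nonneg _).trans hC
    · have := sub_le_mul_log_sub (hf₁nn p) h0
      have h2 := hf₁nn p
      simp only [energyDensity]
      simp only [hu] at *
      linarith [le_abs_self (quad (moment f₁) p - η)]
  -- The negative part of the integrand is bounded by `C`, so no `⊤ - ⊤` occurs and finite energy
  -- forces a finite positive part.
  have hneg : ∫⁻ p, (-E p).toENNReal ∂surfaceMeasure ≠ ⊤ := by
    refine ne_top_of_le_ne_top (b := ∫⁻ _, ENNReal.ofReal C ∂surfaceMeasure) ?_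
      (lintegral_mono fun p => ?_)
    · simp [ENNReal.mul_eq_top]
    · by_cases h : u p ≤ 0 → f₁ p = 0
      · dsimp only
        rw [hreal p h, ← EReal.coe_neg, EReal.toENNReal_of_ne_top (EReal.coe_ne_top _),
          EReal.toReal_coe]
        exact ENNReal.ofReal_le_ofReal (hlow p h)
      · push Not at h
        simp [htop p h.1 h.2]
  have hpos : ∫⁻ p, (E p).toENNReal ∂surfaceMeasure ≠ ⊤ := by
    intro h
    unfold extIntegral at hfin
    rw [h] at hfin
    have h2 : ((∫⁻ p, (-E p).toENNReal ∂surfaceMeasure : ℝ≥0∞) : EReal) ≠ ⊤ := by simpa using hneg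
    rw [EReal.coe_ennreal_top, EReal.top_sub h2] at hfin
    exact lt_irrefl _ hfin
  have hT : MeasurableSet {p | u p ≤ 0 ∧ f₁ p ≠ 0} :=
    (measurableSet_le hum measurable_const).inter (hf₁m (measurableSet_singleton 0)).compl
  have hT0 : surfaceMeasure {p | u p ≤ 0 ∧ f₁ p ≠ 0} = 0 := by
    by_contra hne
    apply hpos
    rw [eq_top_iff, ← ENNReal.top_mul hne, ← lintegral_indicator_const hT]
    refine lintegral_mono fun p => ?_
    by_cases hp : p ∈ {p | u p ≤ 0 ∧ f₁ p ≠ 0}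
    · simp [htop p hp.1 hp.2]
    · simp [Set.indicator_of_notMem hp]
  have hae : ∀ᵐ p ∂surfaceMeasure, u p ≤ 0 → f₁ p = 0 := by
    rw [ae_iff]
    simpa using hT0
  have hei : Integrable (energyDensity η f₁) surfaceMeasure := by
    have hm := measurable_energyDensity (η := η) hf₁m
    have h1 : ∫⁻ p, ENNReal.ofReal (energyDensity η f₁ p) ∂surfaceMeasure ≠ ⊤ := by
      rw [lintegral_congr_ae (g := fun p => (E p).toENNReal)]
      · exact hpos
      · filter_upwards [hae] with p hp
        rw [hreal p hp, EReal.toENNReal_of_ne_top (EReal.coe_ne_top _), EReal.toReal_coe]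
    have h2 : ∫⁻ p, ENNReal.ofReal (-energyDensity η f₁ p) ∂surfaceMeasure ≠ ⊤ := by
      refine ne_top_of_le_ne_top (b := ∫⁻ _, ENNReal.ofReal C ∂surfaceMeasure) ?_
        (lintegral_mono_ae ?_)
      · simp [ENNReal.mul_eq_top]
      · filter_upwards [hae] with p hp
        exact ENNReal.ofReal_le_ofReal (hlow p hp)
    refine ⟨hm.aestronglyMeasurable, ?_⟩
    rw [hasFiniteIntegral_iff_norm]
    have h3 : ∀ p, ENNReal.ofReal ‖energyDensity η f₁ p‖ ≤ ENNReal.ofReal (energyDensity η f₁ p)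
        + ENNReal.ofReal (-energyDensity η f₁ p) := by
      intro p
      rcases le_total 0 (energyDensity η f₁ p) with h | h
      · rw [Real.norm_of_nonneg h]; exact le_self_add
      · rw [Real.norm_of_nonpos h]; exact le_add_self
    refine (lintegral_mono h3).trans_lt ?_
    rw [lintegral_add_left hm.ennreal_ofReal]
    exact ENNReal.add_lt_top.2 ⟨h1.lt_top, h2.lt_top⟩
  have hg₁ : {p | 0 < u p}.indicator f₁ =ᵐ[surfaceMeasure] f₁ := by
    filter_upwards [hae] with p hp
    by_cases h : 0 < u p
    · simp [h]
    · simp [h, hp (not_lt.1 h)]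
  have hmom := moment_congr hg₁
  refine ⟨{p | 0 < u p}.indicator f₁, ⟨?_, ?_, hf₁i.congr hg₁.symm, ?_, ?_, ?_⟩, hg₁.trans hf₁⟩
  · exact hf₁m.indicator (measurableSet_lt measurable_const hum)
  · exact fun p => Set.indicator_nonneg (fun p _ => hf₁nn p) p
  · rw [integral_congr_ae (hg₁.trans hf₁), hone]
  · intro p hp
    rw [hmom] at hp
    rw [Set.indicator_of_notMem]
    exact fun h : 0 < u p => absurd hp (not_le.2 h)
  · refine hei.congr ?_
    filter_upwards [hg₁] with p hp
    simp only [energyDensity, hp, hmom]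

/-- An `L^r`-local minimiser minimises the energy among admissible densities that are uniformly
close to it. -/
lemma IsLpLocalMin.exists_uniform {η : ℝ} {r : ℝ≥0∞} {f f₀ : Sphere2 → ℝ}
    (hmin : IsLpLocalMin η r f) (h₀ : IsAdmissible η f₀) (hf : f₀ =ᵐ[surfaceMeasure] f) :
    ∃ ε : ℝ, 0 < ε ∧ ∀ g, IsAdmissible η g → (∀ p, |g p - f₀ p| ≤ ε) →
      ∫ p, energyDensity η f₀ p ∂surfaceMeasure ≤ ∫ p, energyDensity η g p ∂surfaceMeasure := by
  obtain ⟨-, ε, hε, hloc⟩ := hmin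
  -- The norm of the constant function `1`. For `r = ∞` the exponent is `0` and `K = 1`. The `+ 1`
  -- below makes the inequality strict.
  let K : ℝ≥0∞ := surfaceMeasure Set.univ ^ r.toReal⁻¹
  have hK : K ≠ ⊤ := ENNReal.rpow_ne_top_of_nonneg (by positivity) (measure_ne_top _ _)
  have hK0 : 0 ≤ K.toReal := ENNReal.toReal_nonneg
  refine ⟨ε / (K.toReal + 1), by positivity, fun g hg hclose => ?_⟩
  have h1 : eLpNorm (g - f) r surfaceMeasure = eLpNorm (g - f₀) r surfaceMeasure :=
    eLpNorm_congr_ae (hf.mono fun p hp => by simp [hp])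
  have h2 : eLpNorm (g - f) r surfaceMeasure < ENNReal.ofReal ε := by
    rw [h1]
    refine (eLpNorm_le_of_ae_bound (C := ε / (K.toReal + 1))
      (Filter.Eventually.of_forall hclose)).trans_lt ?_
    calc K * ENNReal.ofReal (ε / (K.toReal + 1))
        = ENNReal.ofReal (K.toReal * (ε / (K.toReal + 1))) := by
          rw [ENNReal.ofReal_mul hK0, ENNReal.ofReal_toReal hK]
      _ < ENNReal.ofReal ε := by
          refine (ENNReal.ofReal_lt_ofReal_iff hε).2 ?_
          rw [mul_div_assoc', div_lt_iff₀ (by positivity)]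
          nlinarith
  have h3 := hloc g hg.isProbDensity h2
  rw [← energy_congr h₀.integrable hf, h₀.energy_eq, hg.energy_eq] at h3
  exact_mod_cast h3

/-! ### Relative entropy and first-order tests -/

/-- The relative entropy density `x ln (x / v) - x + v`. -/
def relEntropy (x v : ℝ) : ℝ := x * Real.log x - x * Real.log v - x + v

lemma relEntropy_nonneg {x v : ℝ} (hx : 0 ≤ x) (hv : 0 < v) : 0 ≤ relEntropy x v := by
  have := sub_le_mul_log_sub hx hv
  unfold relEntropy; linarith

@[simp]
lemma relEntropy_self (v : ℝ) : relEntropy v v = 0 := by unfold relEntropy; ring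

/-- From `ln y ≤ y - 1` at `y = x/v`. A competitor that differs from `v` by `O(t)`, where `v` is
bounded below, therefore costs only `O(t²)`. -/
lemma relEntropy_le {x v : ℝ} (hx : 0 ≤ x) (hv : 0 < v) : relEntropy x v ≤ (x - v) ^ 2 / v := by
  unfold relEntropy
  rcases hx.eq_or_lt with rfl | hx
  · have : (0 - v) ^ 2 / v = v := by field_simp; ring
    rw [this]; simp
  · have h := Real.log_le_sub_one_of_pos (div_pos hx hv)
    rw [Real.log_div hx.ne' hv.ne'] at h
    have h2 := mul_le_mul_of_nonneg_left h hx.le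
    have h3 : (x - v) ^ 2 / v = x * (x / v - 1) - x + v := by field_simp; ring
    rw [h3]; linarith

/-- The first-order expansion at `x` has remainder exactly `relEntropy y x`, which `relEntropy_le`
bounds. -/
lemma relEntropy_le_taylor {x y v : ℝ} (hx : 0 < x) (hy : 0 ≤ y) :
    relEntropy y v ≤ relEntropy x v + (y - x) * (Real.log x - Real.log v) + (y - x) ^ 2 / x := by
  have := relEntropy_le hy hx
  unfold relEntropy at *
  linarith

/-- Convexity of `x ln x`, together with the zero of the relative entropy at `x = v`. -/
lemma relEntropy_segment_le {x v s : ℝ} (hx : 0 ≤ x) (hv : 0 < v) (hs : 0 ≤ s) (hs1 : s ≤ 1) :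
    relEntropy (x + s * (v - x)) v ≤ (1 - s) * relEntropy x v := by
  have h := Real.convexOn_mul_log.2 (Set.mem_Ici.2 hx) (Set.mem_Ici.2 hv.le)
    (sub_nonneg.2 hs1) hs (by ring)
  simp only [smul_eq_mul] at h
  have h2 : (1 - s) * x + s * v = x + s * (v - x) := by ring
  rw [h2] at h
  unfold relEntropy
  linarith

lemma eq_of_relEntropy_eq_zero {x v : ℝ} (hx : 0 ≤ x) (hv : 0 < v) (h : relEntropy x v = 0) :
    x = v := by
  unfold relEntropy at h
  rcases hx.eq_or_lt with rfl | hx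
  · simpa using h.symm
  · by_contra hne
    have hl : Real.log v - Real.log x ≠ 0 := fun h0 =>
      hne (Real.log_injOn_pos (Set.mem_Ioi.2 hx) (Set.mem_Ioi.2 hv) (by linarith))
    have h1 := Real.add_one_lt_exp hl
    rw [Real.exp_sub, Real.exp_log hv, Real.exp_log hx, lt_div_iff₀ hx] at h1
    linarith

lemma measurable_relEntropy {g v : Sphere2 → ℝ} (hg : Measurable g) (hv : Measurable v) :
    Measurable fun p => relEntropy (g p) (v p) := by
  unfold relEntropy; fun_prop

/-- Dividing by `t` and taking `t` small removes the quadratic error. Each of the three variational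
arguments ends with this test. -/
lemma nonpos_of_forall_mul_le {I K t₀ : ℝ} (h0 : 0 < t₀)
    (h : ∀ t, 0 < t → t ≤ t₀ → t * I ≤ t ^ 2 * K) : I ≤ 0 := by
  by_contra! hI
  have hK : ∀ t, 0 < t → t ≤ t₀ → I ≤ t * K := fun t ht ht' => by
    have := h t ht ht'
    rw [sq, mul_assoc] at this
    exact le_of_mul_le_mul_left this ht
  have hK0 : 0 < K := by
    have := hK t₀ h0 le_rfl
    by_contra! h; nlinarith
  have h1 := hK (min t₀ (I / (2 * K))) (by positivity) (min_le_left _ _)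
  have h2 : min t₀ (I / (2 * K)) * K ≤ I / (2 * K) * K :=
    mul_le_mul_of_nonneg_right (min_le_right _ _) hK0.le
  have h3 : I / (2 * K) * K = I / 2 := by field_simp
  linarith

/-! ### Decomposition of the energy -/

/-- The function `exp(B p · p) max(Q p · p - η, 0)`. -/
def profile (η : ℝ) (B Q : Matrix (Fin 3) (Fin 3) ℝ) (p : Sphere2) : ℝ :=
  Real.exp (quad B p) * max (quad Q p - η) 0

@[fun_prop]
lemma measurable_profile (η : ℝ) (B Q : Matrix (Fin 3) (Fin 3) ℝ) :
    Measurable (profile η B Q) := by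
  unfold profile; fun_prop

lemma profile_nonneg (η : ℝ) (B Q : Matrix (Fin 3) (Fin 3) ℝ) (p : Sphere2) :
    0 ≤ profile η B Q p := by
  unfold profile; positivity

lemma profile_pos {η : ℝ} {B Q : Matrix (Fin 3) (Fin 3) ℝ} {p : Sphere2}
    (h : 0 < quad Q p - η) : 0 < profile η B Q p := by
  unfold profile
  rw [max_eq_left h.le]
  positivity

lemma profile_eq_zero {η : ℝ} {B Q : Matrix (Fin 3) (Fin 3) ℝ} {p : Sphere2}
    (h : quad Q p - η ≤ 0) : profile η B Q p = 0 := by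
  unfold profile
  rw [max_eq_right h, mul_zero]

lemma exp_quad_le (B : Matrix (Fin 3) (Fin 3) ℝ) (p : Sphere2) :
    Real.exp (quad B p) ≤ Real.exp (entrySum B) :=
  Real.exp_le_exp.2 ((le_abs_self _).trans (abs_quad_le B p))

lemma integrable_profile (η : ℝ) (B Q : Matrix (Fin 3) (Fin 3) ℝ) :
    Integrable (profile η B Q) surfaceMeasure := by
  refine integrable_of_bounded (by fun_prop)
    (C := Real.exp (entrySum B) * (entrySum Q + |η|)) fun p => ?_
  rw [abs_of_nonneg (profile_nonneg _ _ _ _)]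
  have h := entrySum_nonneg Q
  have h1 := (le_abs_self _).trans (abs_quad_le Q p)
  refine mul_le_mul (exp_quad_le B p) (max_le ?_ (by positivity)) (le_max_right _ _)
    (by positivity)
  linarith [neg_abs_le η]

/-- Where `Qp·p > η`, the logarithm of the profile is `Bp·p + ln(Qp·p - η)`. Elsewhere the density
and the profile both vanish. -/
lemma energyDensity_eq {η : ℝ} {g : Sphere2 → ℝ} {p : Sphere2}
    (h0 : quad (moment g) p - η ≤ 0 → g p = 0) (B : Matrix (Fin 3) (Fin 3) ℝ) :
    energyDensity η g p = relEntropy (g p) (profile η B (moment g) p)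
      + (g p - profile η B (moment g) p) + quad B p * g p := by
  unfold energyDensity relEntropy
  rcases le_or_gt (quad (moment g) p - η) 0 with h | h
  · rw [h0 h, profile_eq_zero h]; simp
  · unfold profile
    rw [max_eq_left h.le, Real.log_mul (Real.exp_pos _).ne' h.ne', Real.log_exp]
    ring

lemma relEntropy_profile_nonneg {η : ℝ} {x : ℝ} {B Q : Matrix (Fin 3) (Fin 3) ℝ} {p : Sphere2}
    (hx : 0 ≤ x) (h0 : quad Q p - η ≤ 0 → x = 0) : 0 ≤ relEntropy x (profile η B Q p) := by
  rcases le_or_gt (quad Q p - η) 0 with h | h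
  · rw [h0 h, profile_eq_zero h]; simp
  · exact relEntropy_nonneg hx (profile_pos h)

lemma IsAdmissible.integrable_relEntropy {η : ℝ} {g : Sphere2 → ℝ} (hg : IsAdmissible η g)
    (B : Matrix (Fin 3) (Fin 3) ℝ) :
    Integrable (fun p => relEntropy (g p) (profile η B (moment g) p)) surfaceMeasure := by
  refine ((hg.integrable_energyDensity.sub (hg.integrable.sub (integrable_profile η B
    (moment g)))).sub (integrable_quad_mul hg.integrable B)).congr
    (Filter.Eventually.of_forall fun p => ?_)
  simp only [Pi.sub_apply, energyDensity_eq (hg.eq_zero p) B]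
  ring

/-- For a given second moment everything but the relative entropy is constant, for every choice of
`B`. -/
lemma IsAdmissible.integral_energyDensity {η : ℝ} {g : Sphere2 → ℝ} (hg : IsAdmissible η g)
    (B : Matrix (Fin 3) (Fin 3) ℝ) :
    ∫ p, energyDensity η g p ∂surfaceMeasure =
      ∫ p, relEntropy (g p) (profile η B (moment g) p) ∂surfaceMeasure
        + (1 - ∫ p, profile η B (moment g) p ∂surfaceMeasure)
        + frobeniusInner B (secondMoment g) := by
  have hp := integrable_profile η B (moment g)
  have h1 : Integrable (fun p => g p - profile η B (moment g) p) surfaceMeasure :=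
    hg.integrable.sub hp
  have h2 : ∫ p, (g p - profile η B (moment g) p) ∂surfaceMeasure
      = 1 - ∫ p, profile η B (moment g) p ∂surfaceMeasure := by
    rw [integral_sub hg.integrable hp, hg.integral_eq]
  have h3 : Integrable (fun p => relEntropy (g p) (profile η B (moment g) p)
      + (g p - profile η B (moment g) p)) surfaceMeasure := (hg.integrable_relEntropy B).add h1
  rw [← h2, ← integral_quad_mul hg.integrable, ← integral_add (hg.integrable_relEntropy B) h1,
    ← integral_add h3 (integrable_quad_mul hg.integrable B)]
  congr 1; ext p
  exact energyDensity_eq (hg.eq_zero p) B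

lemma IsAdmissible.of_relEntropy_le {η : ℝ} {g R : Sphere2 → ℝ} (hgm : Measurable g)
    (hnn : ∀ p, 0 ≤ g p) (hi : Integrable g surfaceMeasure)
    (hone : ∫ p, g p ∂surfaceMeasure = 1) (hz : ∀ p, quad (moment g) p - η ≤ 0 → g p = 0)
    (B : Matrix (Fin 3) (Fin 3) ℝ) (hR : Integrable R surfaceMeasure)
    (hle : ∀ p, relEntropy (g p) (profile η B (moment g) p) ≤ R p) : IsAdmissible η g := by
  refine ⟨hgm, hnn, hi, hone, hz, ?_⟩
  have h1 : Integrable (fun p => relEntropy (g p) (profile η B (moment g) p)) surfaceMeasure := by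
    refine integrable_of_le_of_le
      (measurable_relEntropy hgm (by fun_prop)).aestronglyMeasurable
      (Filter.Eventually.of_forall fun p => relEntropy_profile_nonneg (hnn p) (hz p))
      (Filter.Eventually.of_forall hle) (integrable_zero _ _ _) hR
  refine ((h1.add (hi.sub (integrable_profile η B (moment g)))).add
    (integrable_quad_mul hi B)).congr (Filter.Eventually.of_forall fun p => ?_)
  simp only [Pi.add_apply, Pi.sub_apply, energyDensity_eq (hz p) B]

/-! ### Variations with fixed second moment -/

/-- `f` minimises the energy among admissible densities at uniform distance at most `ε`. -/
def IsUniformLocalMin (η : ℝ) (f : Sphere2 → ℝ) (ε : ℝ) : Prop :=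
  ∀ g, IsAdmissible η g → (∀ p, |g p - f p| ≤ ε) →
    ∫ p, energyDensity η f p ∂surfaceMeasure ≤ ∫ p, energyDensity η g p ∂surfaceMeasure

/-- Variations that keep the second moment do not decrease the relative entropy. -/
lemma IsUniformLocalMin.integral_variation_nonneg {η ε : ℝ} {f g D : Sphere2 → ℝ}
    (hmin : IsUniformLocalMin η f ε) (hf : IsAdmissible η f) (B : Matrix (Fin 3) (Fin 3) ℝ)
    (hgm : Measurable g) (hnn : ∀ p, 0 ≤ g p) (hi : Integrable g surfaceMeasure)
    (hmom : secondMoment g = secondMoment f) (hz : ∀ p, quad (moment f) p - η ≤ 0 → g p = 0)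
    (hclose : ∀ p, |g p - f p| ≤ ε) (hD : Integrable D surfaceMeasure)
    (hle : ∀ p, relEntropy (g p) (profile η B (moment f) p) ≤
      relEntropy (f p) (profile η B (moment f) p) + D p) :
    0 ≤ ∫ p, D p ∂surfaceMeasure := by
  have hm : moment g = moment f := by rw [moment_eq hi, moment_eq hf.integrable, hmom]
  have hone : ∫ p, g p ∂surfaceMeasure = 1 := by
    rw [← trace_secondMoment hi, hmom, trace_secondMoment hf.integrable, hf.integral_eq]
  have hfe := hf.integrable_relEntropy B
  have hg : IsAdmissible η g := IsAdmissible.of_relEntropy_le hgm hnn hi hone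
    (by rwa [hm]) B (hfe.add hD) (by rw [hm]; exact hle)
  have h1 := hmin g hg hclose
  rw [hf.integral_energyDensity B, hg.integral_energyDensity B, hmom, hm] at h1
  have hge := hg.integrable_relEntropy B
  rw [hm] at hge
  have h2 := integral_mono hge (hfe.add hD) hle
  simp only [Pi.add_apply] at h2
  rw [integral_add hfe hD] at h2
  linarith

lemma IsAdmissible.measurableSet_level {η : ℝ} {f : Sphere2 → ℝ} (hf : IsAdmissible η f) (c C : ℝ) :
    MeasurableSet {p | (c ≤ f p ∧ f p ≤ C) ∧ c ≤ quad (moment f) p - η ∧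
      quad (moment f) p - η ≤ C} := by
  have h1 := hf.measurable
  have h2 : Measurable fun p => quad (moment f) p - η := by fun_prop
  exact ((measurableSet_le measurable_const h1).inter (measurableSet_le h1 measurable_const)).inter
    ((measurableSet_le measurable_const h2).inter (measurableSet_le h2 measurable_const))

/-- The sets with `c = 1/(n+1)` and `C = n+1` exhaust `{f > 0}`, which is not null because `f` has
mass one. -/
lemma IsAdmissible.exists_level {η : ℝ} {f : Sphere2 → ℝ} (hf : IsAdmissible η f) :
    ∃ c C : ℝ, 0 < c ∧ 0 < C ∧ surfaceMeasure {p | (c ≤ f p ∧ f p ≤ C) ∧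
      c ≤ quad (moment f) p - η ∧ quad (moment f) p - η ≤ C} ≠ 0 := by
  by_contra! h
  have h1 : ∀ᵐ p ∂surfaceMeasure, ∀ n : ℕ, ¬ ((1 / ((n : ℝ) + 1) ≤ f p ∧ f p ≤ n + 1) ∧
      1 / ((n : ℝ) + 1) ≤ quad (moment f) p - η ∧ quad (moment f) p - η ≤ n + 1) := by
    rw [ae_all_iff]
    intro n
    rw [ae_iff]
    simp only [not_not]
    exact h _ _ (by positivity) (by positivity)
  have h2 : f =ᵐ[surfaceMeasure] 0 := by
    filter_upwards [h1] with p hp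
    by_contra hne
    have hfp : 0 < f p := (hf.nonneg p).lt_of_ne' hne
    have hup : 0 < quad (moment f) p - η := by
      by_contra! h0
      exact hne (hf.eq_zero p h0)
    obtain ⟨n, hn⟩ := exists_nat_gt
      (max (max (f p) (1 / f p)) (max (quad (moment f) p - η) (1 / (quad (moment f) p - η))))
    simp only [max_lt_iff] at hn
    obtain ⟨⟨ha, hb⟩, hc, hd⟩ := hn
    refine hp n ⟨⟨?_, by linarith⟩, ?_, by linarith⟩
    · rw [one_div_le (by positivity) hfp]; linarith
    · rw [one_div_le (by positivity) hup]; linarith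
  have h3 := hf.integral_eq
  rw [integral_congr_ae h2] at h3
  simp at h3

lemma abs_log_le {x c C : ℝ} (hc : 0 < c) (hx : c ≤ x) (hC : x ≤ C) :
    |Real.log x| ≤ |Real.log c| + |Real.log C| := by
  have h1 := Real.log_le_log hc hx
  have h2 := Real.log_le_log (hc.trans_le hx) hC
  rw [abs_le]
  constructor
  · linarith [neg_abs_le (Real.log c), abs_nonneg (Real.log C)]
  · linarith [le_abs_self (Real.log C), abs_nonneg (Real.log c)]

/-- On a set of positive measure, a minimiser is the exponential of a quadratic form times
`Q p · p - η`. -/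
lemma IsUniformLocalMin.exists_eq_profile_on {η ε : ℝ} {f : Sphere2 → ℝ} (hε : 0 < ε)
    (hmin : IsUniformLocalMin η f ε) (hf : IsAdmissible η f) :
    ∃ (S : Set Sphere2) (B : Matrix (Fin 3) (Fin 3) ℝ) (c : ℝ), MeasurableSet S ∧
      surfaceMeasure S ≠ 0 ∧ B.transpose = B ∧ 0 < c ∧
      ∀ p ∈ S, c ≤ f p ∧ f p = profile η B (moment f) p := by
  obtain ⟨c, C, hc, hC, hS0⟩ := hf.exists_level
  have hSm := hf.measurableSet_level c C
  set S : Set Sphere2 := {p | (c ≤ f p ∧ f p ≤ C) ∧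
      c ≤ quad (moment f) p - η ∧ quad (moment f) p - η ≤ C}
  have hfm := hf.measurable
  let ψ : Sphere2 → ℝ := S.indicator fun p => Real.log (f p) - Real.log (quad (moment f) p - η)
  have hψm : Measurable ψ := Measurable.indicator (by fun_prop) hSm
  let L := |Real.log c| + |Real.log C|
  have hψ : ∀ p, |ψ p| ≤ L + L := by
    intro p
    by_cases hp : p ∈ S
    · simp only [ψ, Set.indicator_of_mem hp]
      exact (abs_sub _ _).trans (add_le_add (abs_log_le hc hp.1.1 hp.1.2)
        (abs_log_le hc hp.2.1 hp.2.2))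
    · simp only [ψ, Set.indicator_of_notMem hp, abs_zero]; positivity
  have hψi : Integrable ψ surfaceMeasure := integrable_of_bounded hψm hψ
  obtain ⟨_, _, hcor⟩ := exists_quad_secondMoment hSm hS0
  -- `A` is the `L²(S)` projection of the log-ratio `ψ` onto quadratic forms, so `h` below has zero
  -- second moment.
  obtain ⟨A, hA, hAm, -⟩ := hcor (secondMoment ψ) (secondMoment_transpose ψ)
  let h : Sphere2 → ℝ := fun p => ψ p - S.indicator (quad A) p
  have hhm : Measurable h := hψm.sub ((measurable_quad A).indicator hSm)
  let H := L + L + entrySum A + 1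
  have hH : 0 < H := by have := entrySum_nonneg A; positivity
  have hhH : ∀ p, |h p| ≤ H := by
    intro p
    have h1 : |S.indicator (quad A) p| ≤ entrySum A := by
      by_cases hp : p ∈ S
      · simp only [Set.indicator_of_mem hp]; exact abs_quad_le A p
      · simp only [Set.indicator_of_notMem hp, abs_zero]; exact entrySum_nonneg A
    have := (abs_sub (ψ p) (S.indicator (quad A) p)).trans (add_le_add (hψ p) h1)
    simp only [H, h]; linarith
  have hhi : Integrable h surfaceMeasure := integrable_of_bounded hhm hhH
  have hh0 : secondMoment h = 0 := by
    rw [secondMoment_sub hψi (integrable_indicator_quad hSm A), hAm, sub_self]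
  have hout : ∀ p, p ∉ S → h p = 0 := fun p hp => by simp [h, ψ, hp]
  have hsq : ∀ p, |h p ^ 2| ≤ H ^ 2 := fun p => by
    rw [abs_pow]; exact pow_le_pow_left₀ (abs_nonneg _) (hhH p) 2
  have hsqi : Integrable (fun p => h p ^ 2) surfaceMeasure :=
    integrable_of_bounded (by fun_prop) hsq
  -- The competitor is `f - t h`. The bound on `t` gives `t|h| ≤ ε` for closeness and `t|h| ≤ c` for
  -- nonnegativity on `S`.
  have hI : ∫ p, h p ^ 2 ∂surfaceMeasure ≤ 0 := by
    refine nonpos_of_forall_mul_le (t₀ := min ε c / H)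
      (K := surfaceMeasure.real Set.univ * (H ^ 2 / c)) (by positivity) fun t ht ht' => ?_
    rw [le_div_iff₀ hH] at ht'
    have hth : ∀ p, |t * h p| ≤ min ε c := fun p => by
      rw [abs_mul, abs_of_pos ht]
      exact (mul_le_mul_of_nonneg_left (hhH p) ht.le).trans ht'
    have hDi : Integrable (fun p => t ^ 2 * (H ^ 2 / c) - t * h p ^ 2) surfaceMeasure :=
      (integrable_const _).sub (hsqi.const_mul t)
    have key := hmin.integral_variation_nonneg hf A (g := fun p => f p - t * h p)
      (D := fun p => t ^ 2 * (H ^ 2 / c) - t * h p ^ 2) (by fun_prop) ?_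
      (hf.integrable.sub (hhi.const_mul t)) ?_ ?_ ?_ hDi ?_
    · rw [integral_sub (integrable_const _) (hsqi.const_mul t), integral_const_mul t] at key
      simp only [integral_const, smul_eq_mul] at key
      linarith
    · intro p
      by_cases hp : p ∈ S
      · have h1 := (hth p).trans (min_le_right _ _)
        linarith [hp.1.1, le_abs_self (t * h p)]
      · simpa [hout p hp] using hf.nonneg p
    · rw [secondMoment_sub hf.integrable (hhi.const_mul t), secondMoment_smul, hh0]
      simp
    · intro p hp
      have hpS : p ∉ S := fun h => absurd (hc.trans_le h.2.1) (not_lt.2 hp)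
      simp [hout p hpS, hf.eq_zero p hp]
    · intro p
      have h1 := (hth p).trans (min_le_left _ _)
      simpa using h1
    · intro p
      by_cases hp : p ∈ S
      · have hfp : 0 < f p := hc.trans_le hp.1.1
        have hup : 0 < quad (moment f) p - η := hc.trans_le hp.2.1
        have hy : 0 ≤ f p - t * h p := by
          have h1 := (hth p).trans (min_le_right _ _)
          linarith [hp.1.1, le_abs_self (t * h p)]
        have h2 := relEntropy_le_taylor (v := profile η A (moment f) p) hfp hy
        -- With reference profile given by `A` the log-ratio is `h` itself, so the first-order
        -- change is `-t h²`.
        have h3 : Real.log (f p) - Real.log (profile η A (moment f) p) = h p := by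
          simp only [profile, max_eq_left hup.le, h, ψ, Set.indicator_of_mem hp]
          rw [Real.log_mul (Real.exp_pos _).ne' hup.ne', Real.log_exp]
          ring
        rw [h3] at h2
        have h4 : (f p - t * h p - f p) ^ 2 / f p ≤ t ^ 2 * (H ^ 2 / c) := by
          have e : (f p - t * h p - f p) ^ 2 = t ^ 2 * h p ^ 2 := by ring
          rw [e, mul_div_assoc]
          have := (le_abs_self _).trans (hsq p)
          have := hp.1.1
          gcongr
        linarith
      · have : 0 ≤ t ^ 2 * (H ^ 2 / c) := by positivity
        simpa [hout p hp] using this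
  have hzero : ∀ᵐ p ∂surfaceMeasure, h p = 0 := by
    have h1 := (integral_eq_zero_iff_of_nonneg (fun p => sq_nonneg (h p)) hsqi).1
      (le_antisymm hI (integral_nonneg fun p => sq_nonneg (h p)))
    filter_upwards [h1] with p hp
    simpa using hp
  refine ⟨S ∩ {p | h p = 0}, A, c, hSm.inter (hhm (measurableSet_singleton 0)), ?_, hA, hc, ?_⟩
  · rwa [measure_inter_conull]
    exact hzero
  · rintro p ⟨hp, hp0⟩
    refine ⟨hp.1.1, ?_⟩
    have hfp : 0 < f p := hc.trans_le hp.1.1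
    have hup : 0 < quad (moment f) p - η := hc.trans_le hp.2.1
    simp only [h, ψ, Set.indicator_of_mem hp, Set.mem_ofPred_eq] at hp0
    rw [profile, max_eq_left hup.le]
    rw [show quad A p = Real.log (f p) - Real.log (quad (moment f) p - η) by linarith,
      Real.exp_sub, Real.exp_log hfp, Real.exp_log hup, div_mul_cancel₀ _ hup.ne']

/-- A minimiser is the exponential of a quadratic form times the positive part of
`Q p · p - η`. -/
lemma IsUniformLocalMin.exists_eq_profile {η ε : ℝ} {f : Sphere2 → ℝ} (hε : 0 < ε)
    (hmin : IsUniformLocalMin η f ε) (hf : IsAdmissible η f) :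
    ∃ B : Matrix (Fin 3) (Fin 3) ℝ, B.transpose = B ∧
      profile η B (moment f) =ᵐ[surfaceMeasure] f := by
  obtain ⟨S, B, c, hSm, hS0, hB, hc, hS⟩ := hmin.exists_eq_profile_on hε hf
  refine ⟨B, hB, ?_⟩
  set v := profile η B (moment f) with hv
  have hvm : Measurable v := measurable_profile _ _ _
  have hfm := hf.measurable
  -- The weight keeps `h = s (v - f)` bounded by one although `f` may be unbounded. Then `f + t h`
  -- is a convex combination of `f` and `v` that is uniformly close to `f`.
  let s : Sphere2 → ℝ := fun p => 1 / (1 + |v p - f p|)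
  have hsm : Measurable s := by fun_prop
  have hs0 : ∀ p, 0 < s p := fun p => by positivity
  have hs1 : ∀ p, s p ≤ 1 := fun p => by
    simp only [s]
    rw [div_le_one (by positivity)]
    linarith [abs_nonneg (v p - f p)]
  let h : Sphere2 → ℝ := fun p => s p * (v p - f p)
  have hhm : Measurable h := by fun_prop
  have hh1 : ∀ p, |h p| ≤ 1 := fun p => by
    simp only [h, s, abs_mul]
    rw [abs_of_pos (hs0 p), one_div_mul_eq_div, div_le_one (by positivity)]
    linarith
  have hhi : Integrable h surfaceMeasure := integrable_of_bounded hhm hh1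
  obtain ⟨_, _, hcor⟩ := exists_quad_secondMoment hSm hS0
  obtain ⟨A, hA, hAm, -⟩ := hcor (secondMoment h) (secondMoment_transpose h)
  let k : Sphere2 → ℝ := S.indicator (quad A)
  have hkm : Measurable k := (measurable_quad A).indicator hSm
  let K := entrySum A
  have hK : 0 ≤ K := entrySum_nonneg A
  have hkK : ∀ p, |k p| ≤ K := by
    intro p
    by_cases hp : p ∈ S
    · simp only [k, Set.indicator_of_mem hp]; exact abs_quad_le A p
    · simpa only [k, Set.indicator_of_notMem hp, abs_zero] using hK
  have hki : Integrable k surfaceMeasure := integrable_of_bounded hkm hkK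
  have hkout : ∀ p, p ∉ S → k p = 0 := fun p hp => Set.indicator_of_notMem hp _
  have hhS : ∀ p ∈ S, h p = 0 := fun p hp => by simp [h, ← (hS p hp).2]
  have hre := hf.integrable_relEntropy B
  have hrenn : ∀ p, 0 ≤ relEntropy (f p) (v p) := fun p =>
    relEntropy_profile_nonneg (hf.nonneg p) (hf.eq_zero p)
  have hsre : Integrable (fun p => s p * relEntropy (f p) (v p)) surfaceMeasure :=
    integrable_mul_of_bounded hre hsm (C := 1) fun p => by
      rw [abs_of_pos (hs0 p)]; exact hs1 p
  have hsrenn : ∀ p, 0 ≤ s p * relEntropy (f p) (v p) := fun p =>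
    mul_nonneg (hs0 p).le (hrenn p)
  have hI : ∫ p, s p * relEntropy (f p) (v p) ∂surfaceMeasure ≤ 0 := by
    -- The three bounds on `t (1 + K)` give the convex weight `t s ≤ 1`, closeness `ε`, and `t|k| ≤
    -- c ≤ f` on `S`.
    refine nonpos_of_forall_mul_le (t₀ := min (min 1 ε) c / (1 + K))
      (K := surfaceMeasure.real Set.univ * (K ^ 2 / c)) (by positivity) fun t ht ht' => ?_
    rw [le_div_iff₀ (by positivity), le_min_iff, le_min_iff] at ht'
    obtain ⟨⟨ht1, htε⟩, htc⟩ := ht'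
    have htK : 0 ≤ t * K := by positivity
    have hDi : Integrable (fun p => t ^ 2 * (K ^ 2 / c) - t * (s p * relEntropy (f p) (v p)))
        surfaceMeasure := (integrable_const _).sub (hsre.const_mul t)
    have htk : ∀ p, |t * k p| ≤ t * K := fun p => by
      rw [abs_mul, abs_of_pos ht]
      exact mul_le_mul_of_nonneg_left (hkK p) ht.le
    have hgnn : ∀ p, 0 ≤ f p + t * (h p - k p) := by
      intro p
      by_cases hp : p ∈ S
      · rw [hhS p hp]
        have := htk p
        linarith [(hS p hp).1, le_abs_self (t * k p)]
      · rw [hkout p hp]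
        have h1 : 0 ≤ t * s p := mul_nonneg ht.le (hs0 p).le
        have h2 : t * s p ≤ 1 := mul_le_one₀ (by linarith) (hs0 p).le (hs1 p)
        have e : f p + t * (h p - 0) = (1 - t * s p) * f p + t * s p * v p := by
          simp only [h]; ring
        rw [e]
        exact add_nonneg (mul_nonneg (by linarith) (hf.nonneg p))
          (mul_nonneg h1 (profile_nonneg _ _ _ _))
    have key := hmin.integral_variation_nonneg hf B (g := fun p => f p + t * (h p - k p))
      (D := fun p => t ^ 2 * (K ^ 2 / c) - t * (s p * relEntropy (f p) (v p))) (by fun_prop) hgnn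
      (hf.integrable.add ((hhi.sub hki).const_mul t)) ?_ ?_ ?_ hDi ?_
    · rw [integral_sub (integrable_const _) (hsre.const_mul t), integral_const_mul t] at key
      simp only [integral_const, smul_eq_mul] at key
      linarith
    · have hhk : Integrable (fun p => h p - k p) surfaceMeasure := hhi.sub hki
      rw [secondMoment_add hf.integrable (hhk.const_mul t), secondMoment_smul,
        secondMoment_sub hhi hki, hAm]
      simp
    · intro p hp
      have hpS : p ∉ S := fun hpS => by
        have := (hS p hpS).1
        rw [hf.eq_zero p hp] at this
        linarith
      have hvp : v p = 0 := profile_eq_zero hp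
      simp [hkout p hpS, h, hvp, hf.eq_zero p hp]
    · intro p
      have e : f p + t * (h p - k p) - f p = t * h p - t * k p := by ring
      rw [e]
      have h1 : |t * h p| ≤ t := by
        rw [abs_mul, abs_of_pos ht]
        exact mul_le_of_le_one_right ht.le (hh1 p)
      have := (abs_sub (t * h p) (t * k p)).trans (add_le_add h1 (htk p))
      linarith
    · intro p
      have hcst : 0 ≤ t ^ 2 * (K ^ 2 / c) := by positivity
      -- On `S`, where `f = v` and `h = 0`, the corrector costs `O(t²)`. Off `S` it vanishes, and
      -- convexity yields the linear gain.
      by_cases hp : p ∈ S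
      · obtain ⟨hpc, hpv⟩ := hS p hp
        have hpv' : f p = v p := hpv
        have hvp : 0 < v p := by rw [← hpv']; linarith
        have h1 := relEntropy_le (hgnn p) hvp
        have h2 : (f p + t * (h p - k p) - v p) ^ 2 / v p ≤ t ^ 2 * (K ^ 2 / c) := by
          have e : (f p + t * (h p - k p) - v p) ^ 2 = t ^ 2 * |k p| ^ 2 := by
            rw [hhS p hp, hpv', sq_abs]; ring
          rw [e, mul_div_assoc, ← hpv']
          have := hkK p
          gcongr
        simp only [← hv, hpv', relEntropy_self] at *
        linarith
      · rw [hkout p hp]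
        rcases le_or_gt (quad (moment f) p - η) 0 with hu | hu
        · have hvp : v p = 0 := profile_eq_zero hu
          have hfp := hf.eq_zero p hu
          simp only [← hv, h, hvp, hfp]
          simpa using hcst
        · have h1 : 0 ≤ t * s p := mul_nonneg ht.le (hs0 p).le
          have h2 : t * s p ≤ 1 := mul_le_one₀ (by linarith) (hs0 p).le (hs1 p)
          have h3 := relEntropy_segment_le (hf.nonneg p)
            (profile_pos (B := B) hu : 0 < v p) h1 h2
          have e : f p + t * (h p - 0) = f p + t * s p * (v p - f p) := by
            simp only [h]; ring
          rw [e]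
          simp only [← hv]
          linarith
  have h1 := (integral_eq_zero_iff_of_nonneg hsrenn hsre).1
    (le_antisymm hI (integral_nonneg hsrenn))
  filter_upwards [h1] with p hp
  rcases le_or_gt (quad (moment f) p - η) 0 with hu | hu
  · rw [hf.eq_zero p hu, hv, profile_eq_zero hu]
  · have h2 : relEntropy (f p) (v p) = 0 := by
      have := (hs0 p).ne'
      simpa [this] using hp
    exact (eq_of_relEntropy_eq_zero (hf.nonneg p) (profile_pos hu) h2).symm

/-! ### Variations of the Q-tensor -/

lemma entrySum_add_le (A B : Matrix (Fin 3) (Fin 3) ℝ) :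
    entrySum (A + B) ≤ entrySum A + entrySum B := by
  simp only [entrySum, ← Finset.sum_add_distrib]
  exact Finset.sum_le_sum fun i _ => Finset.sum_le_sum fun j _ => abs_add_le _ _

lemma entrySum_smul (c : ℝ) (A : Matrix (Fin 3) (Fin 3) ℝ) :
    entrySum (c • A) = |c| * entrySum A := by
  simp [entrySum, Finset.mul_sum, abs_mul]

lemma frobeniusInner_add_right (A B C : Matrix (Fin 3) (Fin 3) ℝ) :
    frobeniusInner A (B + C) = frobeniusInner A B + frobeniusInner A C := by
  simp [frobeniusInner, mul_add, Finset.sum_add_distrib]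

lemma frobeniusInner_sub_right (A B C : Matrix (Fin 3) (Fin 3) ℝ) :
    frobeniusInner A (B - C) = frobeniusInner A B - frobeniusInner A C := by
  simp [frobeniusInner, mul_sub, Finset.sum_sub_distrib]

lemma frobeniusInner_smul_right (c : ℝ) (A B : Matrix (Fin 3) (Fin 3) ℝ) :
    frobeniusInner A (c • B) = c * frobeniusInner A B := by
  simp [frobeniusInner, Finset.mul_sum, mul_left_comm]

lemma frobeniusInner_one_right (A : Matrix (Fin 3) (Fin 3) ℝ) :
    frobeniusInner A 1 = A.trace := by
  simp [frobeniusInner, Matrix.one_apply, Matrix.trace]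

lemma eq_zero_of_frobeniusInner_self {A : Matrix (Fin 3) (Fin 3) ℝ}
    (h : frobeniusInner A A = 0) : A = 0 := by
  ext i j
  have h1 := (Finset.sum_eq_zero_iff_of_nonneg
    (fun i _ => Finset.sum_nonneg fun j _ => mul_self_nonneg (A i j))).1 h i (Finset.mem_univ i)
  have h2 := (Finset.sum_eq_zero_iff_of_nonneg
    (fun j _ => mul_self_nonneg (A i j))).1 h1 j (Finset.mem_univ j)
  simpa using h2

lemma integral_quad_mul_of_trace_eq_zero {g : Sphere2 → ℝ} (hg : Integrable g surfaceMeasure)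
    {A : Matrix (Fin 3) (Fin 3) ℝ} (hA : A.trace = 0) :
    ∫ p, quad A p * g p ∂surfaceMeasure = frobeniusInner A (moment g) := by
  rw [integral_quad_mul hg, moment_eq hg, frobeniusInner_sub_right, frobeniusInner_smul_right,
    frobeniusInner_one_right, hA, mul_zero, sub_zero]

lemma abs_profile_sub_le (η : ℝ) (B Q R : Matrix (Fin 3) (Fin 3) ℝ) (p : Sphere2) :
    |profile η B Q p - profile η B R p| ≤ Real.exp (entrySum B) * |quad Q p - quad R p| := by
  unfold profile
  rw [← mul_sub, abs_mul, abs_of_pos (Real.exp_pos _)]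
  refine mul_le_mul (exp_quad_le B p) ?_ (abs_nonneg _) (Real.exp_pos _).le
  have := abs_max_sub_max_le_abs (quad Q p - η) (quad R p - η) 0
  simpa using this

/-- Division by zero gives `0` where `Qp·p = η`, as the theorem's convention demands. The quotient
is bounded, hence integrable. -/
lemma profile_div_eq (η : ℝ) (B Q : Matrix (Fin 3) (Fin 3) ℝ) (p : Sphere2) :
    profile η B Q p / (quad Q p - η) = if 0 < quad Q p - η then Real.exp (quad B p) else 0 := by
  unfold profile
  split_ifs with h
  · rw [max_eq_left h.le, mul_div_cancel_right₀ _ h.ne']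
  · rw [max_eq_right (not_lt.1 h), mul_zero, zero_div]

lemma integrable_profile_div (η : ℝ) (B Q : Matrix (Fin 3) (Fin 3) ℝ) :
    Integrable (fun p => profile η B Q p / (quad Q p - η)) surfaceMeasure := by
  refine integrable_of_bounded (by fun_prop) (C := Real.exp (entrySum B)) fun p => ?_
  rw [profile_div_eq]
  split_ifs
  · rw [abs_of_pos (Real.exp_pos _)]; exact exp_quad_le B p
  · rw [abs_zero]; positivity

/-- Convexity of the positive part: the quotient on the right comes from a subgradient, so no
differentiability in `t` is needed. -/
lemma profile_sub_le (η : ℝ) (B Q M : Matrix (Fin 3) (Fin 3) ℝ) (t : ℝ) (p : Sphere2) :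
    profile η B Q p - profile η B (Q + t • M) p ≤
      -(t * (quad M p * (profile η B Q p / (quad Q p - η)))) := by
  rw [profile_div_eq]
  split_ifs with h
  · unfold profile
    rw [max_eq_left h.le, quad_add, quad_smul]
    have h1 := mul_le_mul_of_nonneg_left (le_max_left (quad Q p + t * quad M p - η) 0)
      (Real.exp_pos (quad B p)).le
    linarith
  · rw [profile_eq_zero (not_lt.1 h)]
    have := profile_nonneg η B (Q + t • M) p
    simpa using this

/-- Varying the Q-tensor of a minimiser in one direction. -/
lemma IsUniformLocalMin.integral_quad_le {η ε : ℝ} {f : Sphere2 → ℝ} (hε : 0 < ε)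
    (hmin : IsUniformLocalMin η f ε) (hf : IsAdmissible η f) {B M : Matrix (Fin 3) (Fin 3) ℝ}
    (hB : profile η B (moment f) = f) (hM : M ∈ SymTraceless) :
    ∫ p, quad M p * (f p / (quad (moment f) p - η)) ∂surfaceMeasure ≤ frobeniusInner B M := by
  obtain ⟨c, C₀, hc, -, hS0⟩ := hf.exists_level
  have hSm := hf.measurableSet_level c C₀
  set S : Set Sphere2 := {p | (c ≤ f p ∧ f p ≤ C₀) ∧
      c ≤ quad (moment f) p - η ∧ quad (moment f) p - η ≤ C₀}
  obtain ⟨C, hC, hcor⟩ := exists_quad_secondMoment hSm hS0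
  let W := Real.exp (entrySum B)
  have hW : 0 < W := Real.exp_pos _
  let E := entrySum M
  have hE : 0 ≤ E := entrySum_nonneg M
  let m := surfaceMeasure.real (Set.univ : Set Sphere2)
  have hm : 0 ≤ m := measureReal_nonneg
  let K := C * (9 * (W * E * m) + E)
  have hK : 0 ≤ K := by positivity
  have hwi : Integrable (fun p => f p / (quad (moment f) p - η)) surfaceMeasure := by
    have := integrable_profile_div η B (moment f)
    rwa [hB] at this
  have hqi := integrable_quad_mul hwi M
  rw [← sub_nonpos]
  -- The bound `c / 2` keeps, on `S`, the new profile `v ≥ c / 2`, the competitor nonnegative, and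
  -- the perturbed `Qp·p - η` positive. The bound `ε` gives closeness.
  refine nonpos_of_forall_mul_le (t₀ := min ε (c / 2) / (W * E + E + K + 1))
    (K := m * (K ^ 2 / (c / 2))) (by positivity) fun t ht ht' => ?_
  rw [le_div_iff₀ (by positivity), le_min_iff] at ht'
  have htW : 0 ≤ t * (W * E) := by positivity
  have htE : 0 ≤ t * E := by positivity
  have htK : 0 ≤ t * K := by positivity
  let v := profile η B (moment f + t • M)
  have hvm : Measurable v := measurable_profile _ _ _
  have hvi : Integrable v surfaceMeasure := integrable_profile _ _ _
  have hvf : ∀ p, |f p - v p| ≤ t * (W * E) := by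
    intro p
    have h1 := abs_profile_sub_le η B (moment f) (moment f + t • M) p
    rw [hB, quad_add, quad_smul] at h1
    refine h1.trans ?_
    have h2 : |quad (moment f) p - (quad (moment f) p + t * quad M p)| = t * |quad M p| := by
      rw [sub_add_cancel_left, abs_neg, abs_mul, abs_of_pos ht]
    rw [h2]
    have h3 := mul_le_mul_of_nonneg_left (abs_quad_le M p) (mul_pos ht hW).le
    change W * (t * |quad M p|) ≤ _
    linarith
  -- The moment that the corrector must supply for `g` to have second moment exactly that of `f`
  -- plus `t • M`. It is `O(t)`, and the mass stays one because `M` is traceless.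
  let N := secondMoment f - secondMoment v + t • M
  have hN : N.transpose = N := by
    simp only [N, Matrix.transpose_add, Matrix.transpose_sub, Matrix.transpose_smul,
      secondMoment_transpose, hM.1]
  have hNE : C * entrySum N ≤ t * K := by
    have h1 := entrySum_add_le (secondMoment f - secondMoment v) (t • M)
    rw [← secondMoment_sub hf.integrable hvi, entrySum_smul, abs_of_pos ht] at h1
    have h2 := entrySum_secondMoment_le hvf
    have h3 : entrySum N ≤ t * (9 * (W * E * m) + E) := by
      simp only [N]
      rw [← secondMoment_sub hf.integrable hvi]
      linarith
    calc C * entrySum N ≤ C * (t * (9 * (W * E * m) + E)) := mul_le_mul_of_nonneg_left h3 hC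
      _ = t * K := by simp only [K]; ring
  obtain ⟨A, hA, hAm, hAE⟩ := hcor N hN
  let h : Sphere2 → ℝ := S.indicator (quad A)
  have hhm : Measurable h := (measurable_quad A).indicator hSm
  have hhK : ∀ p, |h p| ≤ t * K := by
    intro p
    by_cases hp : p ∈ S
    · simp only [h, Set.indicator_of_mem hp]
      exact (abs_quad_le A p).trans (hAE.trans hNE)
    · simpa only [h, Set.indicator_of_notMem hp, abs_zero] using htK
  have hhi : Integrable h surfaceMeasure := integrable_of_bounded hhm hhK
  have hout : ∀ p, p ∉ S → h p = 0 := fun p hp => Set.indicator_of_notMem hp _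
  have hvS : ∀ p ∈ S, c / 2 ≤ v p := fun p hp => by
    have := (le_abs_self _).trans (hvf p)
    linarith [hp.1.1]
  let g : Sphere2 → ℝ := fun p => v p + h p
  have hgm : Measurable g := hvm.add hhm
  have hgi : Integrable g surfaceMeasure := hvi.add hhi
  have hg2 : secondMoment g = secondMoment f + t • M := by
    rw [secondMoment_add hvi hhi, hAm]
    simp only [N]; abel
  have hgtr : (secondMoment g).trace = (secondMoment f).trace := by
    rw [hg2, Matrix.trace_add, Matrix.trace_smul, hM.2, smul_zero, add_zero]
  have hgone : ∫ p, g p ∂surfaceMeasure = 1 := by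
    rw [← trace_secondMoment hgi, hgtr, trace_secondMoment hf.integrable, hf.integral_eq]
  have hgmom : moment g = moment f + t • M := by
    rw [moment_eq hgi, hgtr, hg2, moment_eq hf.integrable]; abel
  have hgnn : ∀ p, 0 ≤ g p := by
    intro p
    by_cases hp : p ∈ S
    · have := (neg_le_abs _).trans (hhK p)
      simp only [g]
      linarith [hvS p hp]
    · simpa only [g, hout p hp, add_zero] using profile_nonneg _ _ _ _
  have hgz : ∀ p, quad (moment g) p - η ≤ 0 → g p = 0 := by
    intro p hp
    rw [hgmom] at hp
    have hpS : p ∉ S := by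
      intro hpS
      rw [quad_add, quad_smul] at hp
      have h1 := mul_le_mul_of_nonneg_left ((neg_le_abs _).trans (abs_quad_le M p)) ht.le
      change t * -quad M p ≤ t * E at h1
      linarith [hpS.2.1]
    simp only [g, hout p hpS, add_zero]
    exact profile_eq_zero hp
  have hre : ∀ p, relEntropy (g p) (profile η B (moment g) p) ≤ t ^ 2 * (K ^ 2 / (c / 2)) := by
    intro p
    rw [hgmom]
    change relEntropy (g p) (v p) ≤ _
    by_cases hp : p ∈ S
    · have hvp := hvS p hp
      refine (relEntropy_le (hgnn p) (by linarith)).trans ?_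
      have e : (g p - v p) ^ 2 = |h p| ^ 2 := by simp only [g, sq_abs]; ring
      rw [e, ← mul_div_assoc, ← mul_pow]
      have := hhK p
      gcongr
    · simp only [g, hout p hp, add_zero, relEntropy_self]
      positivity
  have hg : IsAdmissible η g :=
    IsAdmissible.of_relEntropy_le hgm hgnn hgi hgone hgz B (integrable_const _) hre
  have key := hmin g hg fun p => by
    have e : g p - f p = h p - (f p - v p) := by simp only [g]; ring
    rw [e]
    have := (abs_sub (h p) (f p - v p)).trans (add_le_add (hhK p) (hvf p))
    linarith
  rw [hf.integral_energyDensity B, hg.integral_energyDensity B, hB, hf.integral_eq, hg2,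
    frobeniusInner_add_right, frobeniusInner_smul_right] at key
  simp only [relEntropy_self, integral_zero, sub_self] at key
  have h1 := integral_mono (hg.integrable_relEntropy B) (integrable_const _) hre
  simp only [integral_const, smul_eq_mul] at h1
  -- `f` has zero relative entropy and `g` has `O(t²)`, so the first-order balance is between this
  -- term and `t B·M`.
  have h2 : 1 - ∫ p, profile η B (moment g) p ∂surfaceMeasure ≤
      -(t * ∫ p, quad M p * (f p / (quad (moment f) p - η)) ∂surfaceMeasure) := by
    have e : 1 - ∫ p, v p ∂surfaceMeasure = ∫ p, (f p - v p) ∂surfaceMeasure := by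
      rw [integral_sub hf.integrable hvi, hf.integral_eq]
    rw [hgmom]
    refine e.le.trans ?_
    rw [← integral_const_mul, ← integral_neg]
    refine integral_mono (hf.integrable.sub hvi) (hqi.const_mul t).neg fun p => ?_
    have := profile_sub_le η B (moment f) M t p
    rw [hB] at this
    exact this
  change _ ≤ t ^ 2 * (surfaceMeasure.real Set.univ * (K ^ 2 / (c / 2)))
  linarith

lemma IsUniformLocalMin.integral_quad_eq {η ε : ℝ} {f : Sphere2 → ℝ} (hε : 0 < ε)
    (hmin : IsUniformLocalMin η f ε) (hf : IsAdmissible η f) {B M : Matrix (Fin 3) (Fin 3) ℝ}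
    (hB : profile η B (moment f) = f) (hM : M ∈ SymTraceless) :
    ∫ p, quad M p * (f p / (quad (moment f) p - η)) ∂surfaceMeasure = frobeniusInner B M := by
  refine le_antisymm (hmin.integral_quad_le hε hf hB hM) ?_
  have h := hmin.integral_quad_le hε hf hB (SymTraceless.smul_mem (-1) hM)
  rw [frobeniusInner_smul_right] at h
  simp only [quad_smul, mul_assoc] at h
  rw [integral_const_mul] at h
  linarith

/-! ### The minimiser's Q-tensor lies in the domain -/

/-- The Q-tensor of an admissible density is physical. -/
lemma IsAdmissible.lt_eigenvalue {η : ℝ} {f : Sphere2 → ℝ} (hf : IsAdmissible η f) {a : ℝ}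
    (ha : Module.End.HasEigenvalue (Matrix.toLin' (moment f)) a) : -(1 / 3) < a := by
  obtain ⟨x, hx⟩ := ha.exists_hasEigenvector
  have hx0 := hx.2
  have hxe : (moment f).mulVec x = a • x := by
    have := hx.apply_eq_smul
    rwa [Matrix.toLin'_apply] at this
  -- For an eigenvector `x`, testing with `x ⊗ x` gives `(a + 1/3)|x|² = ∫ (x·p)² f`, positive
  -- because `x·p ≠ 0` a.e.
  let X : Matrix (Fin 3) (Fin 3) ℝ := Matrix.of fun i j => x i * x j
  have hX : X.transpose = X := by
    ext i j; simp [X, mul_comm]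
  obtain ⟨i₀, hi₀⟩ := Function.ne_iff.1 hx0
  have hX0 : X ≠ 0 := fun h => by
    have := congrFun (congrFun h i₀) i₀
    simp only [X, Matrix.of_apply, Matrix.zero_apply, mul_self_eq_zero] at this
    exact hi₀ this
  have hXq : ∀ p : Sphere2, quad X p = (∑ i, x i * p.1 i) ^ 2 := by
    intro p
    rw [sq, Finset.sum_mul_sum]
    exact Finset.sum_congr rfl fun i _ => Finset.sum_congr rfl fun j _ => by
      simp only [X, Matrix.of_apply]; ring
  have hXf : ∀ p : Sphere2, 0 ≤ quad X p * f p := fun p =>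
    mul_nonneg (by rw [hXq]; positivity) (hf.nonneg p)
  have hpos : 0 < frobeniusInner X (secondMoment f) := by
    rw [← integral_quad_mul hf.integrable]
    refine (integral_nonneg hXf).lt_of_ne' fun h0 => ?_
    have h1 := (integral_eq_zero_iff_of_nonneg hXf (integrable_quad_mul hf.integrable X)).1 h0
    have h2 : f =ᵐ[surfaceMeasure] 0 := by
      filter_upwards [h1, ae_quad_ne_zero hX hX0] with p hp hq
      simpa [hq] using hp
    have h3 := hf.integral_eq
    rw [integral_congr_ae h2] at h3
    simp at h3
  have htr : X.trace = ∑ i, x i * x i := rfl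
  have htrpos : 0 < ∑ i, x i * x i :=
    Finset.sum_pos' (fun i _ => mul_self_nonneg _) ⟨i₀, Finset.mem_univ _, mul_self_pos.2 hi₀⟩
  have h1 : frobeniusInner X (moment f) = a * ∑ i, x i * x i := by
    rw [Finset.mul_sum]
    refine Finset.sum_congr rfl fun i _ => ?_
    have := congrFun hxe i
    simp only [Matrix.mulVec, dotProduct, Pi.smul_apply, smul_eq_mul] at this
    rw [mul_left_comm, ← this, Finset.mul_sum]
    exact Finset.sum_congr rfl fun j _ => by simp only [X, Matrix.of_apply]; ring
  rw [moment_eq hf.integrable, frobeniusInner_sub_right, frobeniusInner_smul_right,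
    frobeniusInner_one_right, htr, trace_secondMoment hf.integrable, hf.integral_eq] at h1
  nlinarith

lemma IsAdmissible.mem_domAuxiliary {η : ℝ} {f : Sphere2 → ℝ} (hf : IsAdmissible η f) :
    (⟨moment f, moment_mem hf.integrable⟩ : SymTraceless) ∈ domAuxiliary η := by
  refine ⟨fun a ha => hf.lt_eigenvalue ha, ?_⟩
  refine (iInf₂_le f ⟨hf.isProbDensity, rfl⟩).trans_lt ?_
  rw [hf.energy_eq]
  exact EReal.coe_lt_top _

/-- On the sphere `Qp·p - η` is the quadratic form of `Q - η I`. This matrix is nonzero, since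
otherwise `f` would vanish identically. -/
lemma IsAdmissible.ae_quad_sub_ne_zero {η : ℝ} {f : Sphere2 → ℝ} (hf : IsAdmissible η f) :
    ∀ᵐ p ∂surfaceMeasure, quad (moment f) p - η ≠ 0 := by
  have hq : ∀ p, quad (moment f - η • 1) p = quad (moment f) p - η := fun p => by
    rw [quad_sub, quad_smul, quad_one, mul_one]
  have h1 : (moment f - η • 1).transpose = moment f - η • 1 := by
    rw [Matrix.transpose_sub, (moment_mem hf.integrable).1, Matrix.transpose_smul,
      Matrix.transpose_one]
  have h2 : moment f - η • 1 ≠ 0 := by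
    intro h0
    have h3 : f = 0 := by
      ext p
      refine hf.eq_zero p ?_
      rw [← hq, h0]
      simp [quad]
    have h4 := hf.integral_eq
    rw [h3] at h4
    simp at h4
  simpa only [hq] using ae_quad_ne_zero h1 h2

lemma IsAdmissible.congr {η : ℝ} {f g : Sphere2 → ℝ} (hf : IsAdmissible η f)
    (h : g =ᵐ[surfaceMeasure] f) (hgm : Measurable g) (hnn : ∀ p, 0 ≤ g p)
    (hz : ∀ p, quad (moment f) p - η ≤ 0 → g p = 0) : IsAdmissible η g := by
  have hm := moment_congr h
  refine ⟨hgm, hnn, hf.integrable.congr h.symm, ?_, by rwa [hm], ?_⟩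
  · rw [integral_congr_ae h, hf.integral_eq]
  · refine hf.integrable_energyDensity.congr ?_
    filter_upwards [h] with p hp
    simp only [energyDensity, hp, hm]

/-! ### Differentiability of the dual function -/

variable {V : Type*} [NormedAddCommGroup V] [NormedSpace ℝ V] [FiniteDimensional ℝ V]

/-- An entry of a linearly parametrised symmetric traceless matrix, as a continuous linear
functional of the parameter. -/
def entryCLM (ι : V →ₗ[ℝ] SymTraceless) (i j : Fin 3) : V →L[ℝ] ℝ :=
  LinearMap.toContinuousLinearMap
    ((Matrix.entryLinearMap ℝ ℝ i j).comp (SymTraceless.subtype.comp ι))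

@[simp]
lemma entryCLM_apply (ι : V →ₗ[ℝ] SymTraceless) (i j : Fin 3) (A : V) :
    entryCLM ι i j A = (ι A).1 i j := rfl

/-- The quadratic form at a point, as a continuous linear functional of the matrix. -/
def quadCLM (ι : V →ₗ[ℝ] SymTraceless) (p : Sphere2) : V →L[ℝ] ℝ :=
  ∑ i, ∑ j, (p.1 i * p.1 j) • entryCLM ι i j

lemma quadCLM_apply (ι : V →ₗ[ℝ] SymTraceless) (p : Sphere2) (A : V) :
    quadCLM ι p A = quad (ι A).1 p := by
  simp only [quadCLM, quad, sum_apply, smul_apply, entryCLM_apply, smul_eq_mul]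
  exact Finset.sum_congr rfl fun i _ => Finset.sum_congr rfl fun j _ => by ring

lemma continuous_quadCLM (ι : V →ₗ[ℝ] SymTraceless) : Continuous (quadCLM ι) := by
  unfold quadCLM
  refine continuous_finsetSum _ fun i _ => continuous_finsetSum _ fun j _ => ?_
  have hc : ∀ k, Continuous fun p : Sphere2 => p.1 k := fun k =>
    (EuclideanSpace.proj (𝕜 := ℝ) k).continuous.comp continuous_subtype_val
  exact ((hc i).mul (hc j)).smul continuous_const

lemma exists_entrySum_le_norm (ι : V →ₗ[ℝ] SymTraceless) :
    ∃ C : ℝ, 0 ≤ C ∧ ∀ A : V, entrySum (ι A).1 ≤ C * ‖A‖ := by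
  refine ⟨∑ i, ∑ j, ‖entryCLM ι i j‖, by positivity, fun A => ?_⟩
  simp only [Finset.sum_mul, entrySum]
  exact Finset.sum_le_sum fun i _ => Finset.sum_le_sum fun j _ => (entryCLM ι i j).le_opNorm A

lemma abs_exp_sub_exp_le {a b R : ℝ} (ha : Real.exp a ≤ R) (hb : Real.exp b ≤ R) :
    |Real.exp a - Real.exp b| ≤ R * |a - b| := by
  have key : ∀ x y : ℝ, Real.exp x ≤ R → Real.exp x - Real.exp y ≤ R * |x - y| := by
    intro x y hx
    have h1 := Real.add_one_le_exp (y - x)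
    rw [Real.exp_sub, le_div_iff₀ (Real.exp_pos x)] at h1
    have h2 := mul_le_mul_of_nonneg_left (le_abs_self (x - y)) (Real.exp_pos x).le
    have h3 := mul_le_mul_of_nonneg_right hx (abs_nonneg (x - y))
    linarith
  rw [abs_sub_le_iff]
  exact ⟨key a b ha, by rw [abs_sub_comm]; exact key b a hb⟩

/-- The derivative of the integrand of the partition function. -/
def profileDeriv (η : ℝ) (ι : V →ₗ[ℝ] SymTraceless) (Q lam : V) (p : Sphere2) :
    (V × V) →L[ℝ] ℝ :=
  profile η (ι lam) (ι Q) p • (quadCLM ι p).comp (ContinuousLinearMap.snd ℝ V V)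
    + (profile η (ι lam) (ι Q) p / (quad (ι Q) p - η)) •
      (quadCLM ι p).comp (ContinuousLinearMap.fst ℝ V V)

lemma hasFDerivAt_profile {η : ℝ} (ι : V →ₗ[ℝ] SymTraceless) {Q lam : V} {p : Sphere2}
    (h : quad (ι Q) p - η ≠ 0) :
    HasFDerivAt (fun x : V × V => profile η (ι x.2) (ι x.1) p)
      (profileDeriv η ι Q lam p) (Q, lam) := by
  have h1 : HasFDerivAt (fun x : V × V => quad (ι x.1) p)
      ((quadCLM ι p).comp (ContinuousLinearMap.fst ℝ V V)) (Q, lam) := by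
    have := ((quadCLM ι p).comp (ContinuousLinearMap.fst ℝ V V)).hasFDerivAt (x := (Q, lam))
    refine this.congr_of_eventuallyEq (Filter.Eventually.of_forall fun x => ?_)
    exact (quadCLM_apply ι p x.1).symm
  have h2 : HasFDerivAt (fun x : V × V => quad (ι x.2) p)
      ((quadCLM ι p).comp (ContinuousLinearMap.snd ℝ V V)) (Q, lam) := by
    have := ((quadCLM ι p).comp (ContinuousLinearMap.snd ℝ V V)).hasFDerivAt (x := (Q, lam))
    refine this.congr_of_eventuallyEq (Filter.Eventually.of_forall fun x => ?_)
    exact (quadCLM_apply ι p x.2).symm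
  have hc : ContinuousAt (fun x : V × V => quad (ι x.1) p - η) (Q, lam) :=
    h1.continuousAt.sub continuousAt_const
  unfold profileDeriv
  rw [profile_div_eq]
  rcases h.lt_or_gt with h0 | h0
  · rw [if_neg (not_lt.2 h0.le), profile_eq_zero h0.le, zero_smul, zero_smul, add_zero]
    refine (hasFDerivAt_const (0 : ℝ) (Q, lam)).congr_of_eventuallyEq ?_
    filter_upwards [hc.eventually_lt continuousAt_const h0] with x hx
    exact profile_eq_zero hx.le
  · rw [if_pos h0]
    have h3 := h2.exp.fun_mul (h1.sub_const η)
    refine (h3.congr_of_eventuallyEq ?_).congr_fderiv ?_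
    · filter_upwards [continuousAt_const.eventually_lt hc h0] with x hx
      simp only [profile, max_eq_left (le_of_lt hx)]
    · simp only [profile, max_eq_left h0.le]
      rw [smul_smul, add_comm, mul_comm]

lemma exists_norm_profile_sub_le (η : ℝ) (ι : V →ₗ[ℝ] SymTraceless) (Q lam : V) :
    ∃ C : ℝ, ∀ (p : Sphere2), ∀ x ∈ Metric.ball (Q, lam) 1,
      ‖profile η (ι x.2) (ι x.1) p - profile η (ι lam) (ι Q) p‖ ≤ C * ‖x - (Q, lam)‖ := by
  obtain ⟨C, hC, hCle⟩ := exists_entrySum_le_norm ι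
  refine ⟨Real.exp (C * (‖lam‖ + 1)) * (C * ‖Q‖ + |η| + 1) * C, fun p x hx => ?_⟩
  have hd : ‖x - (Q, lam)‖ < 1 := by rwa [← dist_eq_norm]
  have hd1 : ‖x.1 - Q‖ ≤ ‖x - (Q, lam)‖ := norm_fst_le (x - (Q, lam))
  have hd2 : ‖x.2 - lam‖ ≤ ‖x - (Q, lam)‖ := norm_snd_le (x - (Q, lam))
  have hx2 : ‖x.2‖ ≤ ‖lam‖ + 1 := by
    have := norm_le_norm_add_norm_sub' x.2 lam
    linarith
  set R := Real.exp (C * (‖lam‖ + 1))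
  have hexp : ∀ A : V, ‖A‖ ≤ ‖lam‖ + 1 → Real.exp (quad (ι A).1 p) ≤ R := fun A hA =>
    (exp_quad_le _ p).trans (Real.exp_le_exp.2 ((hCle A).trans
      (mul_le_mul_of_nonneg_left hA hC)))
  have hq : ∀ A B : V, ‖A - B‖ ≤ ‖x - (Q, lam)‖ →
      |quad (ι A).1 p - quad (ι B).1 p| ≤ C * ‖x - (Q, lam)‖ := fun A B hAB => by
    have h1 := (abs_quad_le _ p).trans (hCle (A - B))
    rw [map_sub, Submodule.coe_sub, quad_sub] at h1
    exact h1.trans (mul_le_mul_of_nonneg_left hAB hC)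
  have h1 : |Real.exp (quad (ι x.2).1 p) - Real.exp (quad (ι lam).1 p)|
      ≤ R * (C * ‖x - (Q, lam)‖) :=
    (abs_exp_sub_exp_le (hexp _ hx2) (hexp _ (by linarith))).trans
      (mul_le_mul_of_nonneg_left (hq _ _ hd2) (Real.exp_pos _).le)
  have h2 : |max (quad (ι x.1).1 p - η) 0 - max (quad (ι Q).1 p - η) 0|
      ≤ C * ‖x - (Q, lam)‖ := by
    refine (abs_max_sub_max_le_abs _ _ 0).trans ?_
    rw [sub_sub_sub_cancel_right]
    exact hq _ _ hd1
  have h3 : |max (quad (ι Q).1 p - η) 0| ≤ C * ‖Q‖ + |η| := by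
    rw [abs_of_nonneg (le_max_right _ _)]
    refine max_le ?_ (by positivity)
    have := (le_abs_self _).trans ((abs_quad_le (ι Q).1 p).trans (hCle Q))
    linarith [neg_abs_le η]
  have e : profile η (ι x.2) (ι x.1) p - profile η (ι lam) (ι Q) p
      = (Real.exp (quad (ι x.2).1 p) - Real.exp (quad (ι lam).1 p)) * max (quad (ι Q).1 p - η) 0
        + Real.exp (quad (ι x.2).1 p) *
          (max (quad (ι x.1).1 p - η) 0 - max (quad (ι Q).1 p - η) 0) := by
    unfold profile; ring
  rw [e]
  refine (norm_add_le _ _).trans ?_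
  rw [norm_mul, norm_mul, Real.norm_eq_abs, Real.norm_eq_abs, Real.norm_eq_abs, Real.norm_eq_abs,
    abs_of_pos (Real.exp_pos (quad (ι x.2).1 p))]
  have h4 := mul_le_mul h1 h3 (abs_nonneg _) (by positivity)
  have h5 := mul_le_mul (hexp _ hx2) h2 (abs_nonneg _) (Real.exp_pos _).le
  linarith

/-- Differentiation under the integral needs the derivative at this one point for almost every `p`,
which excludes the kink, and a Lipschitz bound uniform in `p`. -/
lemma hasFDerivAt_partitionFn {η : ℝ} (ι : V →ₗ[ℝ] SymTraceless) {Q : V} (lam : V)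
    (h : ∀ᵐ p ∂surfaceMeasure, quad (ι Q) p - η ≠ 0) :
    Integrable (profileDeriv η ι Q lam) surfaceMeasure ∧
      HasFDerivAt (fun x : V × V => partitionFn η (ι x.1) (ι x.2))
        (∫ p, profileDeriv η ι Q lam p ∂surfaceMeasure) (Q, lam) := by
  obtain ⟨C, hC⟩ := exists_norm_profile_sub_le η ι Q lam
  refine hasFDerivAt_integral_of_dominated_loc_of_lip'
    (F := fun x : V × V => profile η (ι x.2) (ι x.1)) (x₀ := (Q, lam))
    (bound := fun _ => C)
    (Metric.ball_mem_nhds _ one_pos) (fun x _ => (measurable_profile _ _ _).aestronglyMeasurable)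
    (integrable_profile _ _ _) ?_ (Filter.Eventually.of_forall hC) (integrable_const _)
    (h.mono fun p hp => hasFDerivAt_profile ι hp)
  have h1 := (measurable_profile η (ι lam) (ι Q)).aestronglyMeasurable (μ := surfaceMeasure)
  have h2 := (integrable_profile_div η (ι lam) (ι Q)).aestronglyMeasurable
  have h3 : ∀ L : V × V →L[ℝ] V,
      AEStronglyMeasurable (fun p => (quadCLM ι p).comp L) surfaceMeasure := fun L =>
    ((continuous_quadCLM ι).clm_comp continuous_const).aestronglyMeasurable
  exact (h1.smul (h3 _)).add (h2.smul (h3 _))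

lemma integral_profileDeriv_apply {η : ℝ} {ι : V →ₗ[ℝ] SymTraceless} {Q lam : V}
    (h : Integrable (profileDeriv η ι Q lam) surfaceMeasure) (M N : V) :
    (∫ p, profileDeriv η ι Q lam p ∂surfaceMeasure) (M, N) =
      frobeniusInner (ι N) (moment (profile η (ι lam) (ι Q)))
        + frobeniusInner (ι M)
          (moment fun p => profile η (ι lam) (ι Q) p / (quad (ι Q) p - η)) := by
  have hp := integrable_profile η (ι lam) (ι Q)
  have hd := integrable_profile_div η (ι lam) (ι Q)
  rw [ContinuousLinearMap.integral_apply h, ← integral_quad_mul_of_trace_eq_zero hp (ι N).2.2,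
    ← integral_quad_mul_of_trace_eq_zero hd (ι M).2.2,
    ← integral_add (integrable_quad_mul hp _) (integrable_quad_mul hd _)]
  congr 1; ext p
  simp only [profileDeriv, add_apply, smul_apply,
    ContinuousLinearMap.comp_apply, ContinuousLinearMap.coe_fst', ContinuousLinearMap.coe_snd',
    quadCLM_apply, smul_eq_mul]
  ring

lemma exists_hasFDerivAt_frobeniusInner (ι : V →ₗ[ℝ] SymTraceless) (Q lam : V) :
    ∃ L : (V × V) →L[ℝ] ℝ,
      HasFDerivAt (fun x : V × V => frobeniusInner (ι x.2) (ι x.1)) L (Q, lam) ∧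
      ∀ M N : V, L (M, N) =
        frobeniusInner (ι N) (ι Q) + frobeniusInner (ι M) (ι lam) := by
  have h1 : ∀ i j, HasFDerivAt (fun x : V × V => (ι x.1).1 i j)
      ((entryCLM ι i j).comp (ContinuousLinearMap.fst ℝ V V)) (Q, lam) := fun i j =>
    ((entryCLM ι i j).comp (ContinuousLinearMap.fst ℝ V V)).hasFDerivAt
  have h2 : ∀ i j, HasFDerivAt (fun x : V × V => (ι x.2).1 i j)
      ((entryCLM ι i j).comp (ContinuousLinearMap.snd ℝ V V)) (Q, lam) := fun i j =>
    ((entryCLM ι i j).comp (ContinuousLinearMap.snd ℝ V V)).hasFDerivAt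
  refine ⟨_, HasFDerivAt.fun_sum fun i _ => HasFDerivAt.fun_sum fun j _ =>
    (h2 i j).fun_mul (h1 i j), fun M N => ?_⟩
  simp only [frobeniusInner, sum_apply, add_apply, smul_apply, ContinuousLinearMap.comp_apply,
    ContinuousLinearMap.coe_fst', ContinuousLinearMap.coe_snd', entryCLM_apply, smul_eq_mul,
    ← Finset.sum_add_distrib]
  exact Finset.sum_congr rfl fun i _ => Finset.sum_congr rfl fun j _ => by ring

/-- The remainder is little-o of `e (y - x)`, which is big-O of `y - x` in the sense of topological
vector spaces, so `E` needs no norm. -/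
lemma hasFDerivAt_zero_comp {W : Type*} [NormedAddCommGroup W] [NormedSpace ℝ W] {f : W → ℝ}
    {E : Type*} [AddCommGroup E] [Module ℝ E] [TopologicalSpace E] (e : E →L[ℝ] W) {x : E}
    (h : HasFDerivAt f (0 : W →L[ℝ] ℝ) (e x)) :
    HasFDerivAt (fun y => f (e y)) (0 : E →L[ℝ] ℝ) x := by
  refine ⟨?_⟩
  have ht : Filter.Tendsto (Prod.map e e) (nhds x ×ˢ pure x) (nhds (e x) ×ˢ pure (e x)) :=
    (e.continuous.tendsto x).prodMap (Filter.tendsto_pure_pure _ _)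
  have h1 := (HasFDerivAtFilter.isLittleOTVS h).comp_tendsto ht
  have h2 := h1.trans_isBigOTVS (e.isBigOTVS_fun_comp (f := fun p : E × E => p.1 - p.2) |>.congr_left
    fun p => (map_sub e p.1 p.2))
  exact h2

/-- `hQ` and `hlam` are the equations for `Q` and `Λ`, multiplied by `Z` and tested against
matrices. They cancel the partial derivatives in `lam` and `Q`. -/
lemma hasFDerivAt_dualFn_zero {η : ℝ} {Q lam : SymTraceless}
    (h : ∀ᵐ p ∂surfaceMeasure, quad Q p - η ≠ 0) (hZ : partitionFn η Q lam ≠ 0)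
    (hQ : ∀ N : SymTraceless, frobeniusInner N (moment (profile η lam Q)) =
      partitionFn η Q lam * frobeniusInner N Q)
    (hlam : ∀ M : SymTraceless,
      frobeniusInner M (moment fun p => profile η lam Q p / (quad Q p - η)) =
        partitionFn η Q lam * frobeniusInner M lam) :
    HasFDerivAt (dualFn η) (0 : (SymTraceless × SymTraceless) →L[ℝ] ℝ) (Q, lam) := by
  let e : SymTraceless ≃L[ℝ] EuclideanSpace ℝ (Fin (Module.finrank ℝ SymTraceless)) := toEuclidean
  let ι : EuclideanSpace ℝ (Fin (Module.finrank ℝ SymTraceless)) →ₗ[ℝ] SymTraceless :=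
    e.symm.toLinearEquiv.toLinearMap
  have hι : ∀ A : SymTraceless, ι (e A) = A := fun A => e.symm_apply_apply A
  obtain ⟨hi, hd⟩ := hasFDerivAt_partitionFn ι (Q := e Q) (e lam) (by rwa [hι])
  obtain ⟨L, hL, hLa⟩ := exists_hasFDerivAt_frobeniusInner ι (e Q) (e lam)
  have h1 := hL.fun_sub (hd.log (by simpa only [hι] using hZ))
  have h2 := h1.congr_fderiv (g' := 0) (by
    refine ContinuousLinearMap.ext fun x => ?_
    obtain ⟨M, N⟩ := x
    simp only [sub_apply, smul_apply, hLa, integral_profileDeriv_apply hi, hι, hQ, hlam,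
      smul_eq_mul, zero_apply]
    field_simp
    ring)
  have h3 := hasFDerivAt_zero_comp
    (e.toContinuousLinearMap.prodMap e.toContinuousLinearMap) (x := (Q, lam)) h2
  refine h3.congr_of_eventuallyEq ?_
  refine Filter.Eventually.of_forall fun x => ?_
  change frobeniusInner x.2 x.1 - Real.log (partitionFn η x.1 x.2) =
    frobeniusInner (ι (e x.2)) (ι (e x.1))
      - Real.log (partitionFn η (ι (e x.1)) (ι (e x.2)))
  rw [hι, hι]

end QTensorModel

end

/-! ### The Euler–Lagrange equation -/

open QTensorModel in
theorem mainTheorem2 (η : ℝ) (r : ENNReal) (hr : 1 ≤ r)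
    (f : QTensorModel.Sphere2 → ℝ)
    (hmin : QTensorModel.IsLpLocalMin η r f)
    (hfin : QTensorModel.energy η f < ⊤) :
    ∃ Q Λ : QTensorModel.SymTraceless,
      0 < QTensorModel.partitionFn η Q Λ ∧
      (∀ᵐ p ∂QTensorModel.surfaceMeasure,
        f p = 1 / QTensorModel.partitionFn η Q Λ *
          (Real.exp (QTensorModel.quad Λ p) * max (QTensorModel.quad Q p - η) 0)) ∧
      (Q : Matrix (Fin 3) (Fin 3) ℝ) = QTensorModel.moment f ∧
      MeasureTheory.Integrable (fun p => f p / (QTensorModel.quad Q p - η))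
        QTensorModel.surfaceMeasure ∧
      (Λ : Matrix (Fin 3) (Fin 3) ℝ) =
        QTensorModel.moment (fun p => f p / (QTensorModel.quad Q p - η)) ∧
      QTensorModel.IsDualCriticalPoint η Q Λ := by
  obtain ⟨f₀, hf₀, hff₀⟩ := exists_isAdmissible hmin.1 hfin
  obtain ⟨ε₀, hε₀, hmin₀⟩ := hmin.exists_uniform hf₀ hff₀
  obtain ⟨B, hB, hBf⟩ := IsUniformLocalMin.exists_eq_profile hε₀ hmin₀ hf₀
  -- The representative is replaced by the profile itself, so that the equality holds at every
  -- point, as the variation of `Q` requires.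
  set f₁ := profile η B (moment f₀) with hf₁def
  have hf₁ : IsAdmissible η f₁ := hf₀.congr hBf (measurable_profile _ _ _)
    (profile_nonneg _ _ _) (fun p hp => profile_eq_zero hp)
  have hff₁ := hBf.trans hff₀
  obtain ⟨ε, hε, hmin₁⟩ := hmin.exists_uniform hf₁ hff₁
  have hBf₁ : profile η B (moment f₁) = f₁ := by rw [moment_congr hBf]
  let Q : SymTraceless := ⟨moment f₁, moment_mem hf₁.integrable⟩
  let w : Sphere2 → ℝ := fun p => f₁ p / (quad Q p - η)
  have hwi : Integrable w surfaceMeasure := by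
    have := integrable_profile_div η B (moment f₁)
    rwa [hBf₁] at this
  let Λ : SymTraceless := ⟨moment w, moment_mem hwi⟩
  -- Subtracting `c I` makes `B` traceless and multiplies the profile by `exp(-c)`, which turns out
  -- to be `Z`.
  let c := B.trace / 3
  have hΛ : Λ.1 = B - c • 1 := by
    have hmem : B - c • 1 ∈ SymTraceless := by
      refine ⟨?_, ?_⟩
      · rw [Matrix.transpose_sub, hB, Matrix.transpose_smul, Matrix.transpose_one]
      · rw [Matrix.trace_sub, Matrix.trace_smul, Matrix.trace_one]
        simp [c]
    have hD := SymTraceless.sub_mem Λ.2 hmem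
    rw [← sub_eq_zero]
    refine eq_zero_of_frobeniusInner_self ?_
    -- With `D = Λ - (B - c I)` as test direction, `D·Λ = D·B`, and `D` has trace zero. Hence `D·D =
    -- 0`.
    have h1 := IsUniformLocalMin.integral_quad_eq hε hmin₁ hf₁ hBf₁ hD
    have h2 := integral_quad_mul_of_trace_eq_zero hwi hD.2
    have h3 := h2.symm.trans h1
    rw [frobeniusInner_sub_right, frobeniusInner_sub_right, frobeniusInner_smul_right,
      frobeniusInner_one_right, hD.2, h3, frobeniusInner_comm B]
    ring
  have hquad : ∀ p, quad Λ.1 p = quad B p - c := fun p => by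
    rw [hΛ, quad_sub, quad_smul, quad_one, mul_one]
  have hprof : profile η Λ Q = fun p => Real.exp (-c) * f₁ p := by
    ext p
    conv_rhs => rw [← hBf₁]
    unfold profile
    rw [hquad, sub_eq_add_neg, Real.exp_add]
    ring
  have hZ : partitionFn η Q Λ = Real.exp (-c) := by
    change ∫ p, profile η Λ Q p ∂surfaceMeasure = _
    rw [hprof, integral_const_mul, hf₁.integral_eq, mul_one]
  have hZpos : 0 < partitionFn η Q Λ := by rw [hZ]; positivity
  have hw : w =ᵐ[surfaceMeasure] fun p => f p / (quad Q p - η) :=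
    hff₁.mono fun p hp => by simp only [w, hp]
  have hmom : ∀ (a : ℝ) (g : Sphere2 → ℝ), moment (fun p => a * g p) = a • moment g := by
    intro a g
    ext i j
    simp only [moment, Matrix.of_apply, Matrix.smul_apply, smul_eq_mul]
    rw [← integral_const_mul]
    congr 1; ext p; ring
  refine ⟨Q, Λ, hZpos, ?_, moment_congr hff₁, hwi.congr hw, moment_congr hw,
    hf₁.mem_domAuxiliary, ?_⟩
  · filter_upwards [hff₁] with p hp
    have := congrFun hprof p
    change f p = 1 / partitionFn η Q Λ * profile η Λ Q p
    rw [this, hZ, ← hp, ← mul_assoc, one_div, inv_mul_cancel₀ (Real.exp_pos _).ne', one_mul]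
  · refine hasFDerivAt_dualFn_zero hf₁.ae_quad_sub_ne_zero hZpos.ne' (fun N => ?_) (fun M => ?_)
    · rw [hprof, hmom, frobeniusInner_smul_right, hZ]
    · rw [hprof, hZ]
      simp only [mul_div_assoc]
      rw [hmom, frobeniusInner_smul_right]
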